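/- Fix a prime $p$ and an integer $e\ge 1$. Let $W_e$ be the group of Witt vectors of length $e$ over $\mathbb F_p$, with group law $H(\bar X,\bar Y)\in(\mathbb F_p[\bar X,\bar Y])^e$. For $\mathbf i,\mathbf j,\mathbf l\in\mathbb N^e$ let $\alpha_{\mathbf i,\mathbf j}(\mathbf l)\in\mathbb F_p$ be the coefficient of $\bar X^{\mathbf j}\bar Y^{\mathbf i}$ in $H(\bar X,\bar Y)^{\mathbf l}$. The canonical $W_e$-derivation $\mathbb D^{W_e}=(d_{\mathbf j})_{\mathbf j\in\mathbb N^e}$ on $\mathbb F_p(\bar X)$ is the unique extension to the fraction field of the ring homomorphism $\mathbb F_p[\bar X]\to\mathbb F_p[\bar X][[\bar Y]]$, $X_k\mapsto H_k(\bar X,\bar Y)$; here $d_{\mathbf j}(f)$ is the coefficient of $\bar Y^{\mathbf j}$. The elements $\delta^{\mathbf i}_{\mathbf j}(\bar X):=d_{\mathbf j}(\bar X^{\mathbf i})$ are polynomials over $\mathbb F_p$. Let $\mathcal L^0=\{+,-,\cdot,0,1\}$, $\mathcal L^0_B=\mathcal L^0\cup\{b_1,\dots,b_e\}$ (constants), $\mathcal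 L^*=\mathcal L^0\cup\{D_{\mathbf j}\}_{\mathbf j\in\mathbb N^e}$ (unary function symbols) and $\mathcal L^*_B=\mathcal L^*\cup\{b_1,\dots,b_e\}$. Write $[m]=\{0,\dots,m-1\}$. * $\mathrm{SCF}_{p,e}$ is the $\mathcal L^0$-theory of separably closed fields $K$ of characteristic $p$ with $[K:K^p]=p^e$. * $\mathrm{SCF}^B_{p,e}=\mathrm{SCF}_{p,e}\cup\{\alpha\}$ in $\mathcal L^0_B$, where $\alpha$ says that $\sum_{\mathbf i\in[p]^e}x_{\mathbf i}^p\,\bar b^{\mathbf i}=0$ implies that all $x_{\mathbf i}$ are $0$. * $W_e\text{-}\mathrm{DCF}$ is the $\mathcal L^*$-theory consisting of $\mathrm{SCF}_{p,e}$ and the axioms of a strict $W_e$-derivation, for all $\mathbf i,\mathbf j$: $D_{\mathbf 0}(x)=x$; $D_{\mathbf j}(x+y)=D_{\mathbf j}(x)+D_{\mathbf j}(y)$; $D_{\mathbf j}(xy)=\sum_{\mathbf k+\mathbf l=\mathbf j}D_{\mathbf k}(x)D_{\mathbf l}(y)$; $D_{\mathbf i}(D_{\mathbf j}(x))=\sum_{\mathbf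 l}\alpha_{\mathbf i,\mathbf j}(\mathbf l)D_{\mathbf l}(x)$; and (strictness) $\ker D_{(1,0,\dots,0)}\cap\dots\cap\ker D_{(0,\dots,0,1)}=K^p$. * $W_e\text{-}\mathrm{DCF}^B=W_e\text{-}\mathrm{DCF}\cup\{\alpha\}\cup\{D_{\mathbf j}(\bar b^{\mathbf i})=\delta^{\mathbf i}_{\mathbf j}(\bar b):\mathbf i,\mathbf j\in\mathbb N^e\}$ in $\mathcal L^*_B$. * For $\mathbf j\in\mathbb N^e$ and $n\ge\max\{j_1,\dots,j_e\}$ let $\psi_{\mathbf j,n}(x,y)$ be the $\mathcal L^0_B$-formula saying that there are $a_{\mathbf i}$ $(\mathbf i\in[p^n]^e)$ with $$x=\sum_{\mathbf i\in[p^n]^e}a_{\mathbf i}^{p^n}\bar b^{\mathbf i}\quad\text{and}\quad y=\sum_{\mathbf i\in[p^n]^e}a_{\mathbf i}^{p^n}\delta^{\mathbf i}_{\mathbf j}(\bar b).$$ $(\mathrm{SCF}^B_{p,e})^*$ is the $\mathcal L^*_B$-theory $\mathrm{SCF}^B_{p,e}$ together with the axioms $\forall x\,\forall y\,\bigl(D_{\mathbf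 j}(x)=y\leftrightarrow\psi_{\mathbf j,n}(x,y)\bigr)$ for all $\mathbf j$ and all $n\ge\max\{j_1,\dots,j_e\}$. Then: 1. $(\mathrm{SCF}^B_{p,e})^*$ and $W_e\text{-}\mathrm{DCF}^B$ have the same logical consequences. 2. The first theory is an expansion by definitions of $\mathrm{SCF}^B_{p,e}$: for every $\mathbf j$ and every $n\ge\max\{j_1,\dots,j_e\}$, $\mathrm{SCF}^B_{p,e}$ proves $\forall x\,\exists!y\,\psi_{\mathbf j,n}(x,y)$, and for all $n,m\ge\max\{j_1,\dots,j_e\}$ it proves $\forall x\,\forall y\,(\psi_{\mathbf j,n}(x,y)\leftrightarrow\psi_{\mathbf j,m}(x,y))$. 3. In every model $(K,\mathbb D,\bar b)$ of $W_e\text{-}\mathrm{DCF}^B$ the set $B=\{b_1,\dots,b_e\}$ is a canonical $W_e$-basis. That is, $|B|=e$; $B$ is $p$-independent in $K$ over the field of constants $C_K=\ker D_{(1,0,\dots,0)}\cap\dots\cap\ker D_{(0,\dots,0,1)}$ (the monomials in $B$ with exponents less than $p$ are linearly independent over $K^p(C_K)$); and there is a field embedding $\varphi:\mathbb F_p(\bar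 X)\to K$ with $\varphi\circ d_{\mathbf j}=D_{\mathbf j}\circ\varphi$ for all $\mathbf j$ and $\varphi(\{X_1,\dots,X_e\})=B$. -/

import Mathlib

open FirstOrder

namespace WittSCF

noncomputable section

open Language FirstOrder.Ring

/-! ### The Witt group `W_e` over `𝔽_p` and its canonical derivation -/

section Witt

variable (p e : ℕ) [hp : Fact p.Prime]

/-- The group law `H(X, Y)` of the Witt group `W_e` over `𝔽_p` (Witt vectors of length `e`, as a
group under addition): the components of the sum of the two generic Witt vectors
`(X_1, …, X_e)` and `(Y_1, …, Y_e)`.  The variable `X_k` is `inl k`, the variable `Y_k` is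
`inr k`. -/
def wittLaw (k : Fin e) : MvPolynomial (Fin e ⊕ Fin e) (ZMod p) :=
  (TruncatedWittVector.mk p (fun i : Fin e =>
      (MvPolynomial.X (Sum.inl i) : MvPolynomial (Fin e ⊕ Fin e) (ZMod p))) +
    TruncatedWittVector.mk p (fun i : Fin e =>
      (MvPolynomial.X (Sum.inr i) : MvPolynomial (Fin e ⊕ Fin e) (ZMod p)))).coeff k

/-- The structure constants of `W_e`-iterativity, `D_i ∘ D_j = ∑_l iterCoeff i j l • D_l`:
`iterCoeff i j l` is the coefficient of `X^j Y^i` in `H(X, Y)^l`. -/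
def iterCoeff (i j l : Fin e →₀ ℕ) : ZMod p :=
  MvPolynomial.coeff (Finsupp.sumElim j i) (∏ k, wittLaw p e k ^ l k)

/-- The ring homomorphism `ev_H : 𝔽_p[X] → 𝔽_p[X]⟦Y⟧`, `X_k ↦ H_k(X, Y)`. -/
def evH : MvPolynomial (Fin e) (ZMod p) →ₐ[ZMod p]
    MvPowerSeries (Fin e) (MvPolynomial (Fin e) (ZMod p)) :=
  MvPolynomial.aeval fun k =>
    MvPolynomial.aeval
      (Sum.elim (fun l => MvPowerSeries.C (MvPolynomial.X l)) (fun l => MvPowerSeries.X l))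
      (wittLaw p e k)

/-- The components `d_j` of the canonical `W_e`-derivation on `𝔽_p[X]`. -/
def dPoly (j : Fin e →₀ ℕ) (f : MvPolynomial (Fin e) (ZMod p)) : MvPolynomial (Fin e) (ZMod p) :=
  MvPowerSeries.coeff j (evH p e f)

/-- The polynomial `δ_j^i(X) = d_j(X^i)`. -/
def delta (i j : Fin e →₀ ℕ) : MvPolynomial (Fin e) (ZMod p) :=
  dPoly p e j (MvPolynomial.monomial i 1)

theorem coeff_truncAdd {S : Type*} [CommRing S] (x y : TruncatedWittVector p e S) (k : Fin e) :
    (x + y).coeff k = (x.out + y.out).coeff k := by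
  conv_lhs => rw [← TruncatedWittVector.truncateFun_out x, ← TruncatedWittVector.truncateFun_out y,
    ← WittVector.truncateFun_add]
  rw [WittVector.coeff_truncateFun]

/-- `H` is given by addition of Witt vectors over every `𝔽_p`-algebra. -/
theorem aeval_wittLaw {R : Type*} [CommRing R] [Algebra (ZMod p) R] (v : Fin e ⊕ Fin e → R)
    (k : Fin e) :
    MvPolynomial.aeval v (wittLaw p e k) =
      (TruncatedWittVector.mk p (fun i => v (Sum.inl i)) +
        TruncatedWittVector.mk p (fun i => v (Sum.inr i))).coeff k := by
  have hout : ∀ w : Fin e → MvPolynomial (Fin e ⊕ Fin e) (ZMod p),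
      WittVector.map (MvPolynomial.aeval v : _ →ₐ[ZMod p] R).toRingHom
        (TruncatedWittVector.mk p w).out =
      (TruncatedWittVector.mk p (fun i => MvPolynomial.aeval v (w i))).out := by
    intro w
    ext n
    rw [WittVector.map_coeff]
    unfold TruncatedWittVector.out
    simp only
    split_ifs
    · rfl
    · simp
  have h := WittVector.map_coeff (p := p) (MvPolynomial.aeval v : _ →ₐ[ZMod p] R).toRingHom
    ((TruncatedWittVector.mk p (fun i : Fin e =>
      (MvPolynomial.X (Sum.inl i) : MvPolynomial (Fin e ⊕ Fin e) (ZMod p)))).out +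
    (TruncatedWittVector.mk p (fun i : Fin e =>
      (MvPolynomial.X (Sum.inr i) : MvPolynomial (Fin e ⊕ Fin e) (ZMod p)))).out) k
  rw [map_add, hout, hout] at h
  simp only [MvPolynomial.aeval_X] at h
  unfold wittLaw
  rw [coeff_truncAdd, coeff_truncAdd, h]
  rfl

theorem truncMk_zero {R : Type*} [CommRing R] :
    TruncatedWittVector.mk p (fun _ : Fin e => (0 : R)) = 0 := by
  ext i
  simp

theorem constantCoeff_evH (f : MvPolynomial (Fin e) (ZMod p)) :
    MvPowerSeries.constantCoeff (evH p e f) = f := by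
  let g : MvPowerSeries (Fin e) (MvPolynomial (Fin e) (ZMod p)) →ₐ[ZMod p]
      MvPolynomial (Fin e) (ZMod p) :=
    { MvPowerSeries.constantCoeff with
      commutes' := fun r => by simp [MvPowerSeries.algebraMap_apply] }
  have h : g.comp (evH p e) = AlgHom.id _ _ := by
    ext1 k
    rw [AlgHom.comp_apply, evH, MvPolynomial.aeval_X, MvPolynomial.comp_aeval_apply, aeval_wittLaw]
    have h1 : ∀ i : Fin e, g (MvPowerSeries.C (MvPolynomial.X i)) = MvPolynomial.X i :=
      fun i => MvPowerSeries.constantCoeff_C _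
    have h2 : ∀ i : Fin e, g (MvPowerSeries.X i) = 0 := fun i => MvPowerSeries.constantCoeff_X _
    simp only [Sum.elim_inl, Sum.elim_inr, h1, h2, truncMk_zero, add_zero]
    simp
  exact DFunLike.congr_fun h f

/-- The field `𝔽_p(X_1, …, X_e)`. -/
abbrev RatFun : Type := FractionRing (MvPolynomial (Fin e) (ZMod p))

/-- `ev_H` followed by the inclusion `𝔽_p[X]⟦Y⟧ → 𝔽_p(X)⟦Y⟧`. -/
def evHToFrac : MvPolynomial (Fin e) (ZMod p) →+* MvPowerSeries (Fin e) (RatFun p e) :=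
  (MvPowerSeries.map (algebraMap (MvPolynomial (Fin e) (ZMod p)) (RatFun p e))).comp
    (evH p e).toRingHom

theorem isUnit_evHToFrac (f : nonZeroDivisors (MvPolynomial (Fin e) (ZMod p))) :
    IsUnit (evHToFrac p e f) := by
  rw [MvPowerSeries.isUnit_iff_constantCoeff]
  have h : MvPowerSeries.constantCoeff (evHToFrac p e f) =
      algebraMap (MvPolynomial (Fin e) (ZMod p)) (RatFun p e) f := by
    conv_rhs => rw [← constantCoeff_evH p e f]
    rfl
  rw [h]
  exact IsLocalization.map_units (RatFun p e) f

/-- The canonical `W_e`-derivation `𝔻^{W_e} : 𝔽_p(X) → 𝔽_p(X)⟦Y⟧`: the unique extension of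
`ev_H` to the fraction field. -/
def canonicalHom : RatFun p e →+* MvPowerSeries (Fin e) (RatFun p e) :=
  IsLocalization.lift (M := nonZeroDivisors (MvPolynomial (Fin e) (ZMod p)))
    (g := evHToFrac p e) (isUnit_evHToFrac p e)

/-- The components `d_j` of the canonical `W_e`-derivation on `𝔽_p(X)`. -/
def dFrac (j : Fin e →₀ ℕ) (f : RatFun p e) : RatFun p e :=
  MvPowerSeries.coeff j (canonicalHom p e f)

/-- The canonical derivation on `𝔽_p(X)` extends the one on `𝔽_p[X]`; in particular
`d_j(X^i)` is the polynomial `delta i j`. -/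
theorem dFrac_algebraMap (j : Fin e →₀ ℕ) (f : MvPolynomial (Fin e) (ZMod p)) :
    dFrac p e j (algebraMap (MvPolynomial (Fin e) (ZMod p)) (RatFun p e) f) =
      algebraMap (MvPolynomial (Fin e) (ZMod p)) (RatFun p e) (dPoly p e j f) := by
  rw [dFrac, canonicalHom, IsLocalization.lift_eq]
  rfl

/-- Only finitely many of the structure constants are nonzero for given `i` and `j`. -/
theorem iterCoeff_eq_zero (i j l : Fin e →₀ ℕ) (h : i.degree + j.degree < l.degree) :
    iterCoeff p e i j l = 0 := by
  have h0 : ∀ k, MvPolynomial.constantCoeff (wittLaw p e k) = 0 := by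
    intro k
    have h1 := aeval_wittLaw p e (fun _ => (0 : ZMod p)) k
    rw [truncMk_zero, add_zero, TruncatedWittVector.coeff_zero] at h1
    have h2 := MvPolynomial.aeval_zero' (S₁ := ZMod p) (wittLaw p e k)
    rw [h1] at h2
    exact h2.symm
  have h2 : ((∏ k, wittLaw p e k ^ l k : MvPolynomial (Fin e ⊕ Fin e) (ZMod p)) :
      MvPowerSeries (Fin e ⊕ Fin e) (ZMod p)).order ≥ l.degree := by
    rw [← MvPolynomial.coeToMvPowerSeries.ringHom_apply, map_prod]
    refine le_trans ?_ (MvPowerSeries.le_order_prod _ _)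
    rw [Finsupp.degree_eq_sum, Nat.cast_sum]
    refine Finset.sum_le_sum fun k _ => ?_
    rw [map_pow]
    refine MvPowerSeries.le_order_pow_of_constantCoeff_eq_zero _ ?_
    rw [MvPolynomial.coeToMvPowerSeries.ringHom_apply,
      ← MvPowerSeries.coeff_zero_eq_constantCoeff_apply, MvPolynomial.coeff_coe]
    exact h0 k
  rw [iterCoeff, ← MvPolynomial.coeff_coe]
  apply MvPowerSeries.coeff_of_lt_order
  refine lt_of_lt_of_le ?_ h2
  rw [Finsupp.degree_eq_sum, Fintype.sum_sum_type]
  simp only [Finsupp.sumElim_inl, Finsupp.sumElim_inr]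
  rw [← Finsupp.degree_eq_sum, ← Finsupp.degree_eq_sum, add_comm]
  exact_mod_cast h

theorem finite_iterCoeff (i j : Fin e →₀ ℕ) : {l | iterCoeff p e i j l ≠ 0}.Finite := by
  refine (Set.finite_Iic (Finsupp.equivFunOnFinite.symm fun _ : Fin e =>
    i.degree + j.degree)).subset fun l hl k => ?_
  by_contra hk
  refine hl (iterCoeff_eq_zero p e i j l ?_)
  exact lt_of_lt_of_le (not_le.1 hk) (Finsupp.le_degree k l)

end Witt

/-! ### Canonical `W_e`-bases -/

section Basis

variable {p e : ℕ} {K : Type*} [Field K]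

/-- The set of constants `C_K = ⋂_k ker D_{(0,…,1,…,0)}`. -/
def constants (D : (Fin e →₀ ℕ) → K → K) : Set K :=
  {x | ∀ k : Fin e, D (Finsupp.single k 1) x = 0}

/-- `B` is `p`-independent in `K` over `C`: the monomials in elements of `B` with all exponents
smaller than `p` are linearly independent over the subfield `K^p(C)`. -/
def IsPIndependent (p : ℕ) (C B : Set K) : Prop :=
  LinearIndependent (Subfield.closure (Set.range (fun x : K => x ^ p) ∪ C))
    (fun m : {m : B →₀ ℕ // ∀ b, m b < p} => m.1.prod fun b a => (b : K) ^ a)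

/-- Canonical `W_e`-bases of a field `K` with a `W_e`-derivation `D`. -/
structure IsCanonicalBasis (p : ℕ) [Fact p.Prime] (D : (Fin e →₀ ℕ) → K → K) (B : Set K) :
    Prop where
  finite : B.Finite
  ncard_eq : B.ncard = e
  pIndependent : IsPIndependent p (constants D) B
  exists_embedding : ∃ φ : RatFun p e →+* K,
    (∀ j f, φ (dFrac p e j f) = D j (φ f)) ∧
    B = φ '' Set.range fun k : Fin e =>
      algebraMap (MvPolynomial (Fin e) (ZMod p)) (RatFun p e) (MvPolynomial.X k)

end Basis

/-! ### Languages -/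

/-- The function symbols `D_j`, `j ∈ ℕ^e`, all of them unary. -/
inductive HSFunc (e : ℕ) : ℕ → Type
  | D (j : Fin e →₀ ℕ) : HSFunc e 1

/-- The language `{D_j : j ∈ ℕ^e}`. -/
def hsLang (e : ℕ) : Language := ⟨HSFunc e, fun _ => Empty⟩

/-- The language `L* = {+, -, ·, 0, 1} ∪ {D_j : j ∈ ℕ^e}`. -/
abbrev LStar (e : ℕ) : Language := Language.ring.sum (hsLang e)

/-- The language `L⁰_B = {+, -, ·, 0, 1} ∪ {b_1, …, b_e}`. -/
abbrev LZeroB (e : ℕ) : Language := Language.ring[[Fin e]]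

/-- The language `L*_B = L* ∪ {b_1, …, b_e}`. -/
abbrev LStarB (e : ℕ) : Language := (LStar e)[[Fin e]]

/-- The inclusion of the language of rings in `L*`. -/
abbrev ringToStar (e : ℕ) : Language.ring →ᴸ LStar e := LHom.sumInl

/-- The inclusion of `L⁰_B` in `L*_B`. -/
abbrev zeroBToStarB (e : ℕ) : LZeroB e →ᴸ LStarB e := (ringToStar e).addConstants (Fin e)

/-- The `L*_B`-structure `(K, D, b)`. -/
@[reducible]
def structureOf {e : ℕ} (K : Type*) [Field K] (D : (Fin e →₀ ℕ) → K → K) (b : Fin e → K) :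
    (LStarB e).Structure K :=
  letI : Language.ring.Structure K := (compatibleRingOfRing K).toStructure
  letI : (hsLang e).Structure K :=
    { funMap := fun f x => match f, x with
        | HSFunc.D j, x => D j (x 0)
      RelMap := fun r _ => r.elim }
  letI : (constantsOn (Fin e)).Structure K := constantsOn.structure b
  Language.withConstantsStructure (LStar e) (Fin e)

/-! ### The theory `SCF_{p,e}` -/

/-- Universal closure of a formula. -/
def close {L : Language} {V : Type} [Finite V] (φ : L.Formula V) : L.Sentence :=
  Formula.iAlls V (φ.relabel Sum.inr)

/-- The equation `P = Q` between polynomials with integer coefficients, as a formula in the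
language of rings. -/
def eqn {V : Type} (P Q : FreeCommRing V) : Language.ring.Formula V :=
  Term.equal (termOfFreeCommRing P) (termOfFreeCommRing Q)

open FreeCommRing in
/-- For monic `f` of degree `n`: if `u f + v f' = 1` for some `u` and `v` of degree less than `n`
(that is, if `f` is separable), then `f` has a root. -/
def sepClosedAxiom (n : ℕ) : Language.ring.Sentence :=
  let V := Fin n ⊕ Fin n ⊕ Fin n
  let gen (c : Fin n → FreeCommRing V) : Polynomial (FreeCommRing V) :=
    ∑ i, Polynomial.C (c i) * Polynomial.X ^ (i : ℕ)
  let f := Polynomial.X ^ n + gen (fun i => of (Sum.inl i))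
  let u := gen (fun i => of (Sum.inr (Sum.inl i)))
  let v := gen (fun i => of (Sum.inr (Sum.inr i)))
  close
    ((Formula.iInf fun k : Fin (2 * n) =>
        eqn ((u * f + v * Polynomial.derivative f - 1).coeff k) 0).imp
      (Formula.iExs Unit
        (eqn (Polynomial.eval₂ (FreeCommRing.map Sum.inl) (of (Sum.inr ())) f) 0)))

open FreeCommRing in
/-- The elements `c i` are linearly independent over the subfield of `p`-th powers:
`∑ x_i ^ p * c_i = 0` implies that all `x_i` are zero. -/
def linIndepFormula {ι V : Type} [Fintype ι] (p : ℕ) (c : ι → FreeCommRing V) :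
    Language.ring.Formula V :=
  Formula.iAlls ι
    ((eqn (∑ i, of (Sum.inr i) ^ p * FreeCommRing.map Sum.inl (c i)) 0).imp
      (Formula.iInf fun i : ι => eqn (of (Sum.inr i)) 0))

open FreeCommRing in
/-- The elements `c i` span the field over its subfield of `p`-th powers. -/
def spanFormula {ι V : Type} [Fintype ι] (p : ℕ) (c : ι → FreeCommRing V) :
    Language.ring.Formula V :=
  Formula.iAlls Unit
    (Formula.iExs ι
      (eqn (of (Sum.inl (Sum.inr ())))
        (∑ i, of (Sum.inr i) ^ p * FreeCommRing.map (Sum.inl ∘ Sum.inl) (c i))))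

/-- Degree of imperfection `e`, that is `[K : K^p] = p^e`: there is a basis of `K` over `K^p`
indexed by the set `[p]^e`, which has `p^e` elements. -/
def imperfectionAxiom (p e : ℕ) : Language.ring.Sentence :=
  Formula.iExs (Fin e → Fin p)
    (linIndepFormula p (fun i => FreeCommRing.of (Sum.inr i)) ⊓
      spanFormula p (fun i => FreeCommRing.of (Sum.inr i)))

/-- The theory `SCF_{p,e}` of separably closed fields of characteristic `p` and degree of
imperfection `e`. -/
def SCF (p e : ℕ) : Language.ring.Theory :=
  Theory.fieldOfChar p ∪ sepClosedAxiom '' {n | 0 < n} ∪ {imperfectionAxiom p e}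

/-- The sentence `α` (with a variable in place of each constant `b_k`): the monomials `b^i`,
`i ∈ [p]^e`, are linearly independent over the `p`-th powers. -/
def alpha (p e : ℕ) : Language.ring.Formula (Fin e) :=
  linIndepFormula p fun i : Fin e → Fin p => ∏ k, FreeCommRing.of k ^ (i k : ℕ)

/-- The theory `SCF_{p,e}^B = SCF_{p,e} ∪ {α}` in the language `L⁰_B`. -/
def SCFB (p e : ℕ) : (LZeroB e).Theory :=
  (Language.ring.lhomWithConstants (Fin e)).onTheory (SCF p e) ∪
    {Formula.equivSentence (alpha p e)}

/-! ### The theory `W_e`-DCF -/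

/-- The term `D_j(t)`. -/
def dTerm {e : ℕ} {V : Type} (j : Fin e →₀ ℕ) (t : (LStar e).Term V) : (LStar e).Term V :=
  Functions.apply₁ (Sum.inr (HSFunc.D j) : (LStar e).Functions 1) t

/-- A polynomial with integer coefficients in the variables `W`, evaluated at terms of `L*`. -/
def polyAt {e : ℕ} {W V : Type} (P : FreeCommRing W) (t : W → (LStar e).Term V) :
    (LStar e).Term V :=
  ((ringToStar e).onTerm (termOfFreeCommRing P)).subst t

section Axioms

variable (p e : ℕ)

open FreeCommRing

/-- `D_0(x) = x`. -/
def zeroAxiom : (LStar e).Sentence :=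
  close (V := Unit) (Term.equal (dTerm 0 (Term.var ())) (Term.var ()))

/-- `D_j(x + y) = D_j(x) + D_j(y)`. -/
def addAxiom (j : Fin e →₀ ℕ) : (LStar e).Sentence :=
  close (V := Fin 2)
    (Term.equal (dTerm j (polyAt (of 0 + of 1) Term.var))
      (polyAt (of 0 + of 1 : FreeCommRing (Fin 2)) fun k => dTerm j (Term.var k)))

/-- `D_j(x y) = ∑_{k + l = j} D_k(x) D_l(y)`. -/
def mulAxiom (j : Fin e →₀ ℕ) : (LStar e).Sentence :=
  close (V := Fin 2)
    (Term.equal (dTerm j (polyAt (of 0 * of 1) Term.var))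
      (polyAt (∑ q ∈ Finset.HasAntidiagonal.antidiagonal j, of (q.1, (0 : Fin 2)) * of (q.2, (1 : Fin 2)))
        fun kv => dTerm kv.1 (Term.var kv.2)))

/-- `D_i(D_j(x)) = ∑_l c_l D_l(x)`, with the structure constants `c_l ∈ 𝔽_p` of `W_e`. -/
def iterAxiom [Fact p.Prime] (i j : Fin e →₀ ℕ) : (LStar e).Sentence :=
  close (V := Unit)
    (Term.equal (dTerm i (dTerm j (Term.var ())))
      (polyAt (∑ l ∈ (finite_iterCoeff p e i j).toFinset,
          ((iterCoeff p e i j l).val : FreeCommRing (Fin e →₀ ℕ)) * of l)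
        fun l => dTerm l (Term.var ())))

/-- Strictness: `⋂_k ker D_{(0,…,1,…,0)}` is the set of `p`-th powers. -/
def strictAxiom : (LStar e).Sentence :=
  close (V := Unit)
    ((Formula.iInf fun k : Fin e =>
        Term.equal (dTerm (Finsupp.single k 1) (Term.var ())) (polyAt 0 Term.var)).iff
      (Formula.iExs Unit
        (Term.equal (Term.var (Sum.inl ())) (polyAt (of (Sum.inr ()) ^ p) Term.var))))

/-- The theory `W_e`-DCF: separably closed fields of characteristic `p` and degree of imperfection
`e` with a strict `W_e`-derivation. -/
def WeDCF [Fact p.Prime] : (LStar e).Theory :=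
  (ringToStar e).onTheory (SCF p e) ∪ {zeroAxiom e} ∪ Set.range (addAxiom e) ∪
    Set.range (mulAxiom e) ∪ Set.range (fun q : (Fin e →₀ ℕ) × (Fin e →₀ ℕ) =>
      iterAxiom p e q.1 q.2) ∪ {strictAxiom p e}

end Axioms

/-! ### The theories `W_e`-DCF^B and `(SCF_{p,e}^B)^*` -/

section Named

variable (p e : ℕ) [Fact p.Prime]

open FreeCommRing

/-- A polynomial over `𝔽_p` with its coefficients lifted to `{0, …, p - 1}`, evaluated at `b`. -/
def liftAt {R : Type*} [CommRing R] (b : Fin e → R) (P : MvPolynomial (Fin e) (ZMod p)) : R :=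
  ∑ m ∈ P.support, ((P.coeff m).val : R) * ∏ k, b k ^ m k

/-- The formula `D_j(b^i) = δ_j^i(b)` in the variables `b_1, …, b_e`. -/
def basisFormula (i j : Fin e →₀ ℕ) : (LStar e).Formula (Fin e) :=
  Term.equal (dTerm j (polyAt (∏ k, of k ^ i k) Term.var))
    (polyAt (liftAt p e of (delta p e i j)) Term.var)

/-- The theory `W_e`-DCF^B. -/
def WeDCFB : (LStarB e).Theory :=
  ((LStar e).lhomWithConstants (Fin e)).onTheory (WeDCF p e) ∪
    {Formula.equivSentence ((ringToStar e).onFormula (alpha p e))} ∪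
    Set.range (fun q : (Fin e →₀ ℕ) × (Fin e →₀ ℕ) =>
      Formula.equivSentence (basisFormula p e q.1 q.2))

/-- The formula defining `D_j(x) = y` through the `p^n`-monomials in `b`:
there are `a_i`, for `i ∈ [p^n]^e`, with `x = ∑ a_i^(p^n) b^i` and `y = ∑ a_i^(p^n) δ_j^i(b)`.
The variable `x` is `inl ()`, the variable `y` is `inr ()`; the `b_k` are the constants. -/
def defFormula (j : Fin e →₀ ℕ) (n : ℕ) : (LZeroB e).Formula (Unit ⊕ Unit) :=
  let I := Fin e → Fin (p ^ n)
  let V := (Fin e ⊕ (Unit ⊕ Unit)) ⊕ I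
  let b (k : Fin e) : FreeCommRing V := of (Sum.inl (Sum.inl k))
  let x : FreeCommRing V := of (Sum.inl (Sum.inr (Sum.inl ())))
  let y : FreeCommRing V := of (Sum.inl (Sum.inr (Sum.inr ())))
  let a (i : I) : FreeCommRing V := of (Sum.inr i)
  let ψ : Language.ring.Formula (Fin e ⊕ (Unit ⊕ Unit)) :=
    Formula.iExs I
      (eqn x (∑ i : I, a i ^ p ^ n * ∏ k, b k ^ (i k : ℕ)) ⊓
        eqn y (∑ i : I, a i ^ p ^ n *
          liftAt p e b (delta p e (Finsupp.equivFunOnFinite.symm fun k => (i k : ℕ)) j)))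
  BoundedFormula.constantsVarsEquiv.symm ψ

/-- The defining axiom `D_j(x) = y ↔ ψ_{j,n}(x, y)`. -/
def defAxiom (j : Fin e →₀ ℕ) (n : ℕ) : (LStarB e).Sentence :=
  close
    ((((LStar e).lhomWithConstants (Fin e)).onFormula
      (Term.equal (dTerm j (Term.var (Sum.inl ()))) (Term.var (Sum.inr ())))).iff
      ((zeroBToStarB e).onFormula (defFormula p e j n)))

/-- The theory `(SCF_{p,e}^B)^*` in the language `L*_B`: the theory `SCF_{p,e}^B` with the defining
axioms for all `j` and all `n ≥ max j`. -/
def SCFBStar : (LStarB e).Theory :=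
  (zeroBToStarB e).onTheory (SCFB p e) ∪
    {φ | ∃ (j : Fin e →₀ ℕ) (n : ℕ), (∀ k, j k ≤ n) ∧ φ = defAxiom p e j n}

end Named

/-- The set of logical consequences of a theory. -/
def consequences {L : Language} (T : L.Theory) : Set L.Sentence := {φ | T ⊨ᵇ φ}

end

end WittSCF

/-! Everything happens in one field `K` of characteristic `p`. Since `[K : K^p] = p^e`, the sentence
`α` makes `b` a `p`-basis (`isPBasis_of_model`). For every `n`, each `x` in `K` is then the value at
`b` of some polynomial `f` whose coefficients have been raised to the power `p^n`; this value is
`twistEval p n b f`. Substituting `H(b, Y)` for `b` gives `twistLaw p n b f`, and `ψ_{j,n}(x, y)`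
says that `y` is its coefficient at `Y^j`.

This coefficient depends only on `x` when `j_k < p^n` for all `k` (`IsPBasis.coeff_twistLaw_congr`).
Because the monomials in `b` with exponents below `p^n` are independent over `K^(p^n)`, two
polynomials with the same twisted value differ by an element of the ideal of the `X_k^(p^n) - b_k`.
As `H` has coefficients in `𝔽_p` it commutes with Frobenius, so this ideal is sent into that of the
`Y_k^(p^n)`. Hence `ψ_{j,n}` defines a function, and one that does not depend on `n`.

These functions form a strict `W_e`-derivation (`IsPBasis.isStrictDerivation`). Additivity and the
Leibniz rule hold because `twistEval` and `twistLaw` are ring homomorphisms. Iterativity is the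
associativity of `W_e` (`dPoly_dPoly`). Strictness holds because the Jacobian of `Y ↦ H(b, Y)` at
`0` is invertible, which is cancellation in `W_e` over the dual numbers (`lawJacobian_isUnit`).

Conversely, for a strict `W_e`-derivation with the prescribed values on monomials in `b`, the map `x
↦ ∑ D_j(x) Y^j` is a ring homomorphism in characteristic `p`. So `D_j` kills `p^n`-th powers for `0
≠ j` with all `j_k < p^n`, and the Leibniz rule forces `D_j` to be the function defined by `ψ_{j,n}`
(`IsStrictDerivation.isTwistCompatible`). The two theories thus have the same models. Finally, a
`p`-basis is algebraically independent over `𝔽_p`, which yields the embedding of `𝔽_p(X)`. -/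

namespace WittSCF

noncomputable section

open Language FirstOrder.Ring

/-! ### The Witt group law on tuples -/

section Law

variable (p : ℕ) [hp : Fact p.Prime] {e : ℕ}

/-- The sum of two tuples in the group `W_e(R)`. -/
def law {R : Type*} [CommRing R] (x y : Fin e → R) (k : Fin e) : R :=
  (TruncatedWittVector.mk p x + TruncatedWittVector.mk p y).coeff k

variable {R S : Type*} [CommRing R] [CommRing S]

theorem mk_law (x y : Fin e → R) :
    TruncatedWittVector.mk p (law p x y) =
      TruncatedWittVector.mk p x + TruncatedWittVector.mk p y := by
  ext k
  rw [TruncatedWittVector.coeff_mk]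
  rfl

omit hp in
theorem mk_injective {R : Type*} :
    Function.Injective (TruncatedWittVector.mk p : (Fin e → R) → TruncatedWittVector p e R) := by
  intro x y h
  funext k
  simpa using congrArg (fun z => TruncatedWittVector.coeff k z) h

theorem law_zero_right (x : Fin e → R) : law p x (fun _ => 0) = x := by
  apply mk_injective p
  rw [mk_law, truncMk_zero, add_zero]

theorem law_comm (x y : Fin e → R) : law p x y = law p y x := by
  apply mk_injective p
  rw [mk_law, mk_law, add_comm]

theorem law_assoc (x y z : Fin e → R) : law p (law p x y) z = law p x (law p y z) := by
  apply mk_injective p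
  simp only [mk_law, add_assoc]

theorem law_left_cancel {x y z : Fin e → R} (h : law p x y = law p x z) : y = z := by
  have h := congrArg (TruncatedWittVector.mk p) h
  rw [mk_law, mk_law] at h
  exact mk_injective p (add_left_cancel h)

variable [Algebra (ZMod p) R] [Algebra (ZMod p) S]

theorem aeval_wittLaw_eq (x y : Fin e → R) (k : Fin e) :
    MvPolynomial.aeval (Sum.elim x y) (wittLaw p e k) = law p x y k := by
  rw [aeval_wittLaw]
  rfl

/-- `H` has coefficients in `ZMod p`, and every ring homomorphism between `ZMod p`-algebras is `ZMod
p`-linear. Frobenius is among the maps to which this is applied. -/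
theorem map_law (f : R →+* S) (x y : Fin e → R) (k : Fin e) :
    f (law p x y k) = law p (fun i => f (x i)) (fun i => f (y i)) k := by
  let g : R →ₐ[ZMod p] S :=
    { f with
      commutes' := fun r => RingHom.congr_fun
        (RingHom.ext_zmod (f.comp (algebraMap (ZMod p) R)) (algebraMap (ZMod p) S)) r }
  rw [← aeval_wittLaw_eq, ← aeval_wittLaw_eq]
  refine (MvPolynomial.comp_aeval_apply (φ := g) _ _).trans ?_
  congr 2
  funext i
  cases i <;> rfl

end Law

/-! ### The canonical derivation in polynomial form -/

section Canonical

variable (p e : ℕ) [hp : Fact p.Prime]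

open MvPolynomial in
/-- The homomorphism `X_k ↦ H_k(X, Y)` with values in `𝔽_p[X][Y]`. -/
def evPoly : MvPolynomial (Fin e) (ZMod p) →ₐ[ZMod p]
    MvPolynomial (Fin e) (MvPolynomial (Fin e) (ZMod p)) :=
  aeval (law p (fun k => C (X k)) X)

/-- `H` is polynomial in `Y`, so the canonical derivation on `𝔽_p[X]` can be composed with itself
among polynomials, with no question of convergence. -/
theorem evH_eq_coe_evPoly (f : MvPolynomial (Fin e) (ZMod p)) :
    evH p e f = (evPoly p e f : MvPowerSeries (Fin e) (MvPolynomial (Fin e) (ZMod p))) := by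
  have h : (evH p e).toRingHom =
      (MvPolynomial.coeToMvPowerSeries.ringHom).comp (evPoly p e).toRingHom := by
    refine MvPolynomial.ringHom_ext' (RingHom.ext_zmod _ _) fun k => ?_
    simp only [AlgHom.toRingHom_eq_coe, RingHom.coe_coe, RingHom.comp_apply]
    rw [evH, evPoly, MvPolynomial.aeval_X, MvPolynomial.aeval_X, aeval_wittLaw_eq, map_law]
    simp [MvPolynomial.coeToMvPowerSeries.ringHom_apply]
  exact RingHom.congr_fun h f

theorem dPoly_eq_coeff (j : Fin e →₀ ℕ) (f : MvPolynomial (Fin e) (ZMod p)) :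
    dPoly p e j f = MvPolynomial.coeff j (evPoly p e f) := by
  rw [dPoly, evH_eq_coe_evPoly, MvPolynomial.coeff_coe]

/-- Reads a structure constant as an iterated coefficient: the `inl` variables become the outer
ones, with exponent `j`, and the `inr` variables the inner ones, with exponent `i`. -/
theorem coeff_coeff_aeval_sumElim {R : Type*} [CommRing R] [Algebra (ZMod p) R]
    (i j : Fin e →₀ ℕ) (P : MvPolynomial (Fin e ⊕ Fin e) (ZMod p)) :
    MvPolynomial.coeff i (MvPolynomial.coeff j (MvPolynomial.aeval
      (Sum.elim MvPolynomial.X (fun k => MvPolynomial.C (MvPolynomial.X k)) :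
        Fin e ⊕ Fin e → MvPolynomial (Fin e) (MvPolynomial (Fin e) R)) P)) =
      algebraMap (ZMod p) R (MvPolynomial.coeff (Finsupp.sumElim j i) P) := by
  classical
  induction P using MvPolynomial.induction_on' with
  | add P Q hP hQ => simp only [map_add, MvPolynomial.coeff_add, hP, hQ]
  | monomial m c =>
    obtain ⟨⟨u, v⟩, rfl⟩ := (Finsupp.sumFinsuppEquivProdFinsupp (α := Fin e) (β := Fin e)
      (γ := ℕ)).symm.surjective m
    have huv : Finsupp.sumFinsuppEquivProdFinsupp.symm (u, v) = Finsupp.sumElim u v := rfl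
    rw [huv, MvPolynomial.aeval_monomial, Finsupp.prod_fintype _ _ (fun _ => pow_zero _),
      Fintype.prod_sum_type]
    simp only [Sum.elim_inl, Sum.elim_inr, Finsupp.sumElim_inl, Finsupp.sumElim_inr]
    have h1 : (∏ k, (MvPolynomial.X k :
        MvPolynomial (Fin e) (MvPolynomial (Fin e) R)) ^ u k) = MvPolynomial.monomial u 1 := by
      rw [MvPolynomial.monomial_eq, Finsupp.prod_fintype _ _ (fun _ => pow_zero _), map_one, one_mul]
    have h2 : (∏ k, (MvPolynomial.C (MvPolynomial.X k) :
        MvPolynomial (Fin e) (MvPolynomial (Fin e) R)) ^ v k) =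
        MvPolynomial.C (MvPolynomial.monomial v 1) := by
      rw [MvPolynomial.monomial_eq, Finsupp.prod_fintype _ _ (fun _ => pow_zero _), map_one, one_mul,
        map_prod]
      simp only [map_pow]
    have h3 : (algebraMap (ZMod p) (MvPolynomial (Fin e) (MvPolynomial (Fin e) R))) c =
        MvPolynomial.C (MvPolynomial.C (algebraMap (ZMod p) R c)) := rfl
    have h4 : Finsupp.sumElim u v = Finsupp.sumElim j i ↔ u = j ∧ v = i := by
      rw [← huv, show Finsupp.sumElim j i = Finsupp.sumFinsuppEquivProdFinsupp.symm (j, i) from rfl,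
        Equiv.apply_eq_iff_eq, Prod.mk.injEq]
    rw [h1, h2, h3, mul_comm (MvPolynomial.monomial u 1), MvPolynomial.coeff_C_mul,
      MvPolynomial.coeff_C_mul, MvPolynomial.coeff_C_mul, MvPolynomial.coeff_monomial,
      MvPolynomial.coeff_monomial]
    simp only [h4]
    by_cases hu : u = j
    · by_cases hv : v = i
      · simp [hu, hv]
      · simp [hu, hv, MvPolynomial.coeff_monomial]
    · simp [hu]

/-- `W_e`-iterativity of the canonical derivation on `𝔽_p[X]`. -/
theorem dPoly_dPoly (i j : Fin e →₀ ℕ) (f : MvPolynomial (Fin e) (ZMod p)) :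
    dPoly p e i (dPoly p e j f) =
      ∑ l ∈ (finite_iterCoeff p e i j).toFinset, iterCoeff p e i j l • dPoly p e l f := by
  classical
  let c : MvPolynomial (Fin e) (ZMod p) →+* MvPolynomial (Fin e) (MvPolynomial (Fin e) (MvPolynomial (Fin e) (ZMod p))) :=
    MvPolynomial.C.comp MvPolynomial.C
  let H : Fin e → MvPolynomial (Fin e) (MvPolynomial (Fin e) (MvPolynomial (Fin e) (ZMod p))) :=
    law p MvPolynomial.X (fun k => MvPolynomial.C (MvPolynomial.X k))
  -- In `𝔽_p[X][Z][Y]` the outer variables `Y` record `j` and the middle variables `Z` record `i`.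
  -- On generators the identity is `H(H(X, Z), Y) = H(X, H(Y, Z))`, by associativity and
  -- commutativity. The coefficient at `Y^j Z^i` is `d_i(d_j f)` on the left and a sum of terms
  -- `d_l(f)` times structure constants on the right.
  have key : (MvPolynomial.map (evPoly p e).toRingHom).comp (evPoly p e).toRingHom =
      (MvPolynomial.eval₂Hom c H).comp (evPoly p e).toRingHom := by
    refine MvPolynomial.ringHom_ext' (RingHom.ext_zmod _ _) fun k => ?_
    simp only [AlgHom.toRingHom_eq_coe, RingHom.coe_coe, RingHom.comp_apply]
    have hX : ∀ k, evPoly p e (MvPolynomial.X k) =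
        law p (R := MvPolynomial (Fin e) (MvPolynomial (Fin e) (ZMod p)))
          (fun k => MvPolynomial.C (MvPolynomial.X k)) MvPolynomial.X k :=
      fun k => MvPolynomial.aeval_X _ _
    rw [hX]
    refine (map_law p (R := MvPolynomial (Fin e) (MvPolynomial (Fin e) (ZMod p)))
      (S := MvPolynomial (Fin e) (MvPolynomial (Fin e) (MvPolynomial (Fin e) (ZMod p))))
      (MvPolynomial.map (evPoly p e).toRingHom) _ _ k).trans (Eq.trans ?_
        (map_law p (R := MvPolynomial (Fin e) (MvPolynomial (Fin e) (ZMod p)))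
          (S := MvPolynomial (Fin e) (MvPolynomial (Fin e) (MvPolynomial (Fin e) (ZMod p))))
          (MvPolynomial.eval₂Hom c H) _ _ k).symm)
    have hC : ∀ i : Fin e, MvPolynomial.map (evPoly p e).toRingHom
        (MvPolynomial.C (MvPolynomial.X i)) = MvPolynomial.C (σ := Fin e) (law p
          (R := MvPolynomial (Fin e) (MvPolynomial (Fin e) (ZMod p)))
          (fun k => MvPolynomial.C (MvPolynomial.X k)) MvPolynomial.X i) := fun i =>
      (MvPolynomial.map_C _ _).trans (congrArg MvPolynomial.C (hX i))
    simp only [hC, MvPolynomial.map_X,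
      MvPolynomial.coe_eval₂Hom, MvPolynomial.eval₂_C, MvPolynomial.eval₂_X]
    have h1 : (fun i : Fin e => (MvPolynomial.C (law p (fun k => MvPolynomial.C (MvPolynomial.X k))
        MvPolynomial.X i : MvPolynomial (Fin e) (MvPolynomial (Fin e) (ZMod p))) :
          MvPolynomial (Fin e) (MvPolynomial (Fin e) (MvPolynomial (Fin e) (ZMod p))))) =
        law p (fun i => c (MvPolynomial.X i)) (fun i => MvPolynomial.C (MvPolynomial.X i)) := by
      funext i
      exact map_law p (R := MvPolynomial (Fin e) (MvPolynomial (Fin e) (ZMod p)))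
        (S := MvPolynomial (Fin e) (MvPolynomial (Fin e) (MvPolynomial (Fin e) (ZMod p))))
        MvPolynomial.C _ _ i
    have h2 : H = law p (R := MvPolynomial (Fin e) (MvPolynomial (Fin e)
        (MvPolynomial (Fin e) (ZMod p)))) (fun k => MvPolynomial.C (MvPolynomial.X k))
        MvPolynomial.X := law_comm _ _ _
    rw [h1, law_assoc]
    change _ = law p (fun i => c (MvPolynomial.X i)) (fun i => H i) k
    rw [show (fun i => H i) = H from rfl, h2]
  have h := congrArg (fun g => MvPolynomial.coeff i (MvPolynomial.coeff j g))
    (RingHom.congr_fun key f)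
  simp only [AlgHom.toRingHom_eq_coe, RingHom.coe_coe, RingHom.comp_apply,
    MvPolynomial.coeff_map] at h
  rw [dPoly_eq_coeff, dPoly_eq_coeff, h, MvPolynomial.coe_eval₂Hom, MvPolynomial.eval₂_eq',
    MvPolynomial.coeff_sum, MvPolynomial.coeff_sum]
  have hterm : ∀ l : Fin e →₀ ℕ, MvPolynomial.coeff i (MvPolynomial.coeff j
      (c (MvPolynomial.coeff l (evPoly p e f)) * ∏ k, H k ^ l k)) =
      iterCoeff p e i j l • dPoly p e l f := by
    intro l
    have h3 : ∏ k, H k ^ l k = MvPolynomial.aeval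
      (Sum.elim MvPolynomial.X (fun k => MvPolynomial.C (MvPolynomial.X k)) :
        Fin e ⊕ Fin e → MvPolynomial (Fin e) (MvPolynomial (Fin e) (MvPolynomial (Fin e) (ZMod p))))
        (∏ k, wittLaw p e k ^ l k) := by
      simp only [map_prod, map_pow]
      exact Finset.prod_congr rfl fun k _ => congrArg (· ^ l k) (aeval_wittLaw_eq p _ _ k).symm
    rw [h3, RingHom.comp_apply, MvPolynomial.coeff_C_mul, MvPolynomial.coeff_C_mul,
      coeff_coeff_aeval_sumElim, dPoly_eq_coeff, mul_comm, ← Algebra.smul_def]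
    rfl
  simp only [hterm]
  -- One sum runs over the support of `evPoly p e f`, the other over the nonzero structure
  -- constants. Both extend by zero to the union.
  have hA : ∀ l, l ∉ (evPoly p e f).support → iterCoeff p e i j l • dPoly p e l f = 0 := by
    intro l hl
    rw [dPoly_eq_coeff, MvPolynomial.notMem_support_iff.1 hl, smul_zero]
  have hB : ∀ l, l ∉ (finite_iterCoeff p e i j).toFinset →
      iterCoeff p e i j l • dPoly p e l f = 0 := by
    intro l hl
    rw [Set.Finite.mem_toFinset, Set.mem_ofPred_eq, not_not] at hl
    rw [hl, zero_smul]
  exact (Finset.sum_subset Finset.subset_union_left fun l _ => hA l).trans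
    (Finset.sum_subset Finset.subset_union_right fun l _ => hB l).symm

end Canonical

/-! ### Evaluation of polynomials with coefficients in `K^(p^n)` -/

section Twist

open MvPolynomial

variable (p : ℕ) [hp : Fact p.Prime] {e : ℕ} {K : Type*} [Field K] [CharP K p]

/-- `∑ a_i X^i ↦ ∑ a_i^(p^n) b^i`. -/
def twistEval (n : ℕ) (b : Fin e → K) : MvPolynomial (Fin e) K →+* K :=
  eval₂Hom (iterateFrobenius K p n) b

/-- `∑ a_i X^i ↦ ∑ a_i^(p^n) H(b, Y)^i`. -/
def twistLaw (n : ℕ) (b : Fin e → K) : MvPolynomial (Fin e) K →+* MvPolynomial (Fin e) K :=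
  eval₂Hom (C.comp (iterateFrobenius K p n)) (law p (fun k => C (b k)) X)

theorem twistEval_C (n : ℕ) (b : Fin e → K) (c : K) : twistEval p n b (C c) = c ^ p ^ n := by
  simp [twistEval, iterateFrobenius_def]

theorem twistLaw_C (n : ℕ) (b : Fin e → K) (c : K) : twistLaw p n b (C c) = C (c ^ p ^ n) := by
  simp [twistLaw, iterateFrobenius_def]

theorem twistEval_X (n : ℕ) (b : Fin e → K) (k : Fin e) : twistEval p n b (X k) = b k := by
  simp [twistEval]

theorem twistLaw_X (n : ℕ) (b : Fin e → K) (k : Fin e) :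
    twistLaw p n b (X k) = law p (fun k => C (b k)) X k := by
  simp [twistLaw]

/-- `c^(p^(n+1)) = (c^p)^(p^n)`: going down one level costs one Frobenius on the coefficients. The
same holds for `twistLaw`. -/
theorem twistEval_succ (n : ℕ) (b : Fin e → K) (f : MvPolynomial (Fin e) K) :
    twistEval p (n + 1) b f = twistEval p n b (map (frobenius K p) f) := by
  refine RingHom.congr_fun (g := (twistEval p n b).comp (map (frobenius K p)))
    (ringHom_ext (fun c => ?_) fun k => ?_) f
  · simp only [RingHom.comp_apply, map_C, twistEval_C, frobenius_def]
    rw [← pow_mul, pow_succ']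
  · simp only [RingHom.comp_apply, map_X, twistEval_X]

theorem twistLaw_succ (n : ℕ) (b : Fin e → K) (f : MvPolynomial (Fin e) K) :
    twistLaw p (n + 1) b f = twistLaw p n b (map (frobenius K p) f) := by
  refine RingHom.congr_fun (g := (twistLaw p n b).comp (map (frobenius K p)))
    (ringHom_ext (fun c => ?_) fun k => ?_) f
  · simp only [RingHom.comp_apply, map_C, twistLaw_C, frobenius_def]
    rw [← pow_mul, pow_succ']
  · simp only [RingHom.comp_apply, map_X, twistLaw_X]

theorem monomial_reduce {A : Type*} [CommRing A] (x c : Fin e → A) (N : ℕ)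
    (h : ∀ k, x k ^ N = c k) (m : Fin e →₀ ℕ) :
    ∏ k, x k ^ m k = (∏ k, c k ^ (m k / N)) * ∏ k, x k ^ (m k % N) := by
  rw [← Finset.prod_mul_distrib]
  refine Finset.prod_congr rfl fun k _ => ?_
  rw [← h k, ← pow_mul, ← pow_add, Nat.div_add_mod]

/-- The polynomial `∑ a_i X^i` with exponents in `[N]^e`. -/
def boxPoly {N : ℕ} (a : (Fin e → Fin N) → K) : MvPolynomial (Fin e) K :=
  ∑ i, monomial (Finsupp.equivFunOnFinite.symm fun k => (i k : ℕ)) (a i)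

theorem boxPoly_add {N : ℕ} (a c : (Fin e → Fin N) → K) :
    boxPoly (a + c) = boxPoly a + boxPoly c := by
  simp [boxPoly, Finset.sum_add_distrib]

theorem boxPoly_single {N : ℕ} (i : Fin e → Fin N) (c : K) [DecidableEq (Fin e → Fin N)] :
    boxPoly (Pi.single i c) = monomial (Finsupp.equivFunOnFinite.symm fun k => (i k : ℕ)) c := by
  rw [boxPoly, Finset.sum_eq_single i]
  · simp
  · intro j _ hj
    simp [hj]
  · simp

/-- Modulo the polynomials `X_k^N - b_k` every polynomial has exponents in `[N]^e`. -/
theorem exists_boxPoly_sub_mem (b : Fin e → K) {N : ℕ} (hN : 0 < N)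
    (f : MvPolynomial (Fin e) K) :
    ∃ a : (Fin e → Fin N) → K,
      f - boxPoly a ∈ Ideal.span (Set.range fun k : Fin e => X k ^ N - C (b k)) := by
  classical
  induction f using MvPolynomial.induction_on' with
  | add f g hf hg =>
    obtain ⟨a, ha⟩ := hf
    obtain ⟨c, hc⟩ := hg
    refine ⟨a + c, ?_⟩
    rw [boxPoly_add, add_sub_add_comm]
    exact Ideal.add_mem _ ha hc
  | monomial m c =>
    -- Division with remainder on exponents: since `X_k^N` is congruent to `b_k`, the quotients move
    -- into the coefficient.
    refine ⟨Pi.single (fun k => ⟨m k % N, Nat.mod_lt _ hN⟩) (c * ∏ k, b k ^ (m k / N)), ?_⟩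
    rw [boxPoly_single, ← Ideal.Quotient.eq, monomial_eq, monomial_eq,
      Finsupp.prod_fintype _ _ (fun _ => pow_zero _), Finsupp.prod_fintype _ _ (fun _ => pow_zero _)]
    simp only [map_mul, map_prod, map_pow, Finsupp.equivFunOnFinite_symm_apply_apply]
    rw [monomial_reduce _ (fun k => Ideal.Quotient.mk _ (C (b k))) N (fun k => ?_) m, mul_assoc]
    rw [← map_pow, Ideal.Quotient.eq]
    exact Ideal.subset_span ⟨k, rfl⟩

theorem twistEval_eq_of_sub_mem (n : ℕ) (b : Fin e → K) {f g : MvPolynomial (Fin e) K}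
    (h : f - g ∈ Ideal.span (Set.range fun k : Fin e => X k ^ p ^ n - C (b k))) :
    twistEval p n b f = twistEval p n b g := by
  rw [← sub_eq_zero, ← map_sub]
  refine (Ideal.span_le (I := RingHom.ker (twistEval p n b))).2 ?_ h
  rintro _ ⟨k, rfl⟩
  simp [RingHom.mem_ker, twistEval_C, twistEval_X]

/-- `H(b, Y)^(p^n) = b^(p^n)` modulo the `Y_k^(p^n)`. -/
theorem law_pow_sub_mem [Algebra (ZMod p) K] (n : ℕ) (b : Fin e → K) (k : Fin e) :
    law p (fun k => C (b k)) X k ^ p ^ n - C (b k ^ p ^ n) ∈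
      Ideal.span (Set.range fun k : Fin e => (X k ^ p ^ n : MvPolynomial (Fin e) K)) := by
  rw [← Ideal.Quotient.eq]
  set q := Ideal.Quotient.mk (Ideal.span (Set.range fun k : Fin e =>
    (X k ^ p ^ n : MvPolynomial (Fin e) K)))
  -- The iterated Frobenius followed by `q` commutes with `H`, and it sends each `Y_k` to `0`; what
  -- remains is `H(b^(p^n), 0) = b^(p^n)`.
  have h := map_law p (q.comp (iterateFrobenius (MvPolynomial (Fin e) K) p n))
    (fun k => C (b k)) X k
  simp only [RingHom.comp_apply, iterateFrobenius_def] at h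
  have h0 : (fun i : Fin e => q (X i ^ p ^ n)) = fun _ => 0 :=
    funext fun i => Ideal.Quotient.eq_zero_iff_mem.2 (Ideal.subset_span ⟨i, rfl⟩)
  rw [h, h0, law_zero_right, C_pow]

/-- A generator `X_k^(p^n) - b_k` goes to `H_k(b, Y)^(p^n) - b_k^(p^n)`, which `law_pow_sub_mem`
places in the target ideal. -/
theorem twistLaw_sub_mem [Algebra (ZMod p) K] (n : ℕ) (b : Fin e → K)
    {f g : MvPolynomial (Fin e) K}
    (h : f - g ∈ Ideal.span (Set.range fun k : Fin e => X k ^ p ^ n - C (b k))) :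
    twistLaw p n b f - twistLaw p n b g ∈
      Ideal.span (Set.range fun k : Fin e => (X k ^ p ^ n : MvPolynomial (Fin e) K)) := by
  rw [← map_sub]
  refine (Ideal.span_le (I := Ideal.comap (twistLaw p n b) (Ideal.span (Set.range fun k : Fin e =>
    (X k ^ p ^ n : MvPolynomial (Fin e) K))))).2 ?_ h
  rintro _ ⟨k, rfl⟩
  rw [SetLike.mem_coe, Ideal.mem_comap, map_sub, map_pow, twistLaw_X, twistLaw_C]
  exact law_pow_sub_mem p n b k

theorem coeff_eq_zero_of_mem {N : ℕ} {f : MvPolynomial (Fin e) K}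
    (hf : f ∈ Ideal.span (Set.range fun k : Fin e => (X k ^ N : MvPolynomial (Fin e) K)))
    {j : Fin e →₀ ℕ} (hj : ∀ k, j k < N) : coeff j f = 0 := by
  have h : (Set.range fun k : Fin e => (X k ^ N : MvPolynomial (Fin e) K)) =
      (fun s => monomial s (1 : K)) '' Set.range fun k : Fin e => Finsupp.single k N := by
    rw [← Set.range_comp]
    congr 1
    funext k
    simp [X_pow_eq_monomial]
  rw [h, mem_ideal_span_monomial_image] at hf
  by_contra hne
  obtain ⟨_, ⟨k, rfl⟩, hle⟩ := hf j (mem_support_iff.2 hne)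
  have := hle k
  rw [Finsupp.single_eq_same] at this
  exact absurd (hj k) (not_lt.2 this)

theorem twistEval_boxPoly (n : ℕ) (b : Fin e → K) {N : ℕ} (a : (Fin e → Fin N) → K) :
    twistEval p n b (boxPoly a) = ∑ i, a i ^ p ^ n * ∏ k, b k ^ (i k : ℕ) := by
  rw [boxPoly, map_sum]
  refine Finset.sum_congr rfl fun i _ => ?_
  rw [monomial_eq, map_mul, twistEval_C, Finsupp.prod_fintype _ _ (fun _ => pow_zero _), map_prod]
  simp [twistEval_X]

/-- Setting `Y = 0` turns `H(b, Y)` into `b`. This gives `D_0(x) = x` later. -/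
theorem constantCoeff_twistLaw (n : ℕ) (b : Fin e → K) [Algebra (ZMod p) K]
    (f : MvPolynomial (Fin e) K) :
    constantCoeff (twistLaw p n b f) = twistEval p n b f := by
  refine RingHom.congr_fun (f := constantCoeff.comp (twistLaw p n b))
    (ringHom_ext (fun c => ?_) fun k => ?_) f
  · simp [twistLaw_C, twistEval_C]
  · rw [RingHom.comp_apply, twistLaw_X, twistEval_X, map_law]
    simp only [constantCoeff_C, constantCoeff_X]
    rw [law_zero_right]

/-! ### Polynomials over `𝔽_p`, whose coefficients are fixed by Frobenius -/

section Alg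

variable [Algebra (ZMod p) K]

theorem twistEval_map (n : ℕ) (b : Fin e → K) (P : MvPolynomial (Fin e) (ZMod p)) :
    twistEval p n b (map (algebraMap (ZMod p) K) P) = aeval b P := by
  refine RingHom.congr_fun (f := (twistEval p n b).comp (map (algebraMap (ZMod p) K)))
    (g := (aeval b : _ →ₐ[ZMod p] K).toRingHom)
    (ringHom_ext' (RingHom.ext_zmod _ _) fun k => ?_) P
  simp [twistEval_X]

theorem twistLaw_map (n : ℕ) (b : Fin e → K) (P : MvPolynomial (Fin e) (ZMod p)) :
    twistLaw p n b (map (algebraMap (ZMod p) K) P) =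
      map (aeval b : _ →ₐ[ZMod p] K).toRingHom (evPoly p e P) := by
  refine RingHom.congr_fun (f := (twistLaw p n b).comp (map (algebraMap (ZMod p) K)))
    (g := (MvPolynomial.map (aeval b : _ →ₐ[ZMod p] K).toRingHom).comp (evPoly p e).toRingHom)
    (ringHom_ext' (RingHom.ext_zmod _ _) fun k => ?_) P
  have hX : evPoly p e (X k) = law p (R := MvPolynomial (Fin e) (MvPolynomial (Fin e) (ZMod p)))
      (fun k => C (X k)) X k := aeval_X _ _
  rw [RingHom.comp_apply, map_X, twistLaw_X, RingHom.comp_apply, AlgHom.toRingHom_eq_coe,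
    AlgHom.toRingHom_eq_coe, RingHom.coe_coe, hX]
  refine Eq.trans ?_ (map_law p (R := MvPolynomial (Fin e) (MvPolynomial (Fin e) (ZMod p)))
    (S := MvPolynomial (Fin e) K)
    (MvPolynomial.map (aeval b : _ →ₐ[ZMod p] K).toRingHom) _ _ k).symm
  simp

theorem coeff_twistLaw_map (n : ℕ) (b : Fin e → K) (P : MvPolynomial (Fin e) (ZMod p))
    (j : Fin e →₀ ℕ) :
    coeff j (twistLaw p n b (map (algebraMap (ZMod p) K) P)) = aeval b (dPoly p e j P) := by
  rw [twistLaw_map, coeff_map, dPoly_eq_coeff]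
  rfl

theorem coeff_twistLaw_monomial (n : ℕ) (b : Fin e → K) (i j : Fin e →₀ ℕ) (c : K) :
    coeff j (twistLaw p n b (monomial i c)) = c ^ p ^ n * aeval b (delta p e i j) := by
  have h : monomial i c = C c * map (algebraMap (ZMod p) K) (monomial i 1) := by
    rw [map_monomial, map_one, C_mul_monomial, mul_one]
  rw [h, map_mul, twistLaw_C, coeff_C_mul, coeff_twistLaw_map, delta]

theorem coeff_twistLaw_boxPoly (n : ℕ) (b : Fin e → K) {N : ℕ} (a : (Fin e → Fin N) → K)
    (j : Fin e →₀ ℕ) :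
    coeff j (twistLaw p n b (boxPoly a)) = ∑ i, a i ^ p ^ n *
      aeval b (delta p e (Finsupp.equivFunOnFinite.symm fun k => (i k : ℕ)) j) := by
  rw [boxPoly, map_sum, coeff_sum]
  exact Finset.sum_congr rfl fun i _ => coeff_twistLaw_monomial p n b _ j _

end Alg

end Twist

/-! ### `p`-bases -/

section PBasis

variable (p : ℕ) [hp : Fact p.Prime] {e : ℕ} {K : Type*} [Field K] [CharP K p]

/-- The monomials `b^i` with exponents less than `p` form a basis of `K` over `K^p`. -/
structure IsPBasis (b : Fin e → K) : Prop where
  indep : ∀ a : (Fin e → Fin p) → K, ∑ i, a i ^ p * ∏ k, b k ^ (i k : ℕ) = 0 → a = 0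
  span : ∀ x, ∃ a : (Fin e → Fin p) → K, x = ∑ i, a i ^ p * ∏ k, b k ^ (i k : ℕ)

/-- Division with remainder by `p` on exponents. -/
def boxEquiv (p e n : ℕ) : (Fin e → Fin (p ^ (n + 1))) ≃ (Fin e → Fin p) × (Fin e → Fin (p ^ n)) :=
  (Equiv.arrowCongr (Equiv.refl _) (finProdFinEquiv (m := p ^ n) (n := p))).symm.trans
    ((Equiv.arrowProdEquivProdArrow _ _ _).trans (Equiv.prodComm _ _))

omit hp in
theorem boxEquiv_symm_apply (n : ℕ) (r : Fin e → Fin p) (q : Fin e → Fin (p ^ n)) (k : Fin e) :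
    ((boxEquiv p e n).symm (r, q) k : ℕ) = r k + p * q k := rfl

/-- Writing an exponent as `r + p q`, the term `a^(p^(n+1)) b^(r + p q)` equals `(a^(p^n) b^q)^p
b^r`. Independence and spanning for `p^n` follow from this by induction on `n`. -/
theorem sum_box_succ (n : ℕ) (b : Fin e → K) (a : (Fin e → Fin (p ^ (n + 1))) → K) :
    ∑ i, a i ^ p ^ (n + 1) * ∏ k, b k ^ (i k : ℕ) =
      ∑ r : Fin e → Fin p, (∑ q : Fin e → Fin (p ^ n),
        a ((boxEquiv p e n).symm (r, q)) ^ p ^ n * ∏ k, b k ^ (q k : ℕ)) ^ p *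
          ∏ k, b k ^ (r k : ℕ) := by
  rw [← (boxEquiv p e n).symm.sum_comp, Fintype.sum_prod_type]
  refine Finset.sum_congr rfl fun r _ => ?_
  rw [sum_pow_char, Finset.sum_mul]
  refine Finset.sum_congr rfl fun q _ => ?_
  rw [mul_pow, ← pow_mul, ← pow_succ, mul_assoc, ← Finset.prod_pow, ← Finset.prod_mul_distrib]
  congr 1
  refine Finset.prod_congr rfl fun k _ => ?_
  rw [boxEquiv_symm_apply, ← pow_mul, ← pow_add, add_comm, mul_comm]

variable {p}

theorem IsPBasis.indep_pow {b : Fin e → K} (hb : IsPBasis p b) (n : ℕ) :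
    ∀ a : (Fin e → Fin (p ^ n)) → K,
      ∑ i, a i ^ p ^ n * ∏ k, b k ^ (i k : ℕ) = 0 → a = 0 := by
  induction n with
  | zero =>
    intro a ha
    have : Subsingleton (Fin (p ^ 0)) := by rw [pow_zero]; infer_instance
    have : Unique (Fin e → Fin (p ^ 0)) :=
      { default := fun _ => ⟨0, by simp⟩, uniq := fun _ => Subsingleton.elim _ _ }
    rw [Fintype.sum_unique] at ha
    funext i
    rw [Unique.eq_default i]
    simpa using ha
  | succ n ih =>
    intro a ha
    rw [sum_box_succ] at ha
    funext i
    obtain ⟨⟨r, q⟩, rfl⟩ := (boxEquiv p e n).symm.surjective i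
    exact congrFun (ih (fun q => a ((boxEquiv p e n).symm (r, q)))
      (congrFun (hb.indep _ ha) r)) q

theorem IsPBasis.span_pow {b : Fin e → K} (hb : IsPBasis p b) (n : ℕ) :
    ∀ x, ∃ a : (Fin e → Fin (p ^ n)) → K, x = ∑ i, a i ^ p ^ n * ∏ k, b k ^ (i k : ℕ) := by
  induction n with
  | zero =>
    intro x
    have : Subsingleton (Fin (p ^ 0)) := by rw [pow_zero]; infer_instance
    have : Unique (Fin e → Fin (p ^ 0)) :=
      { default := fun _ => ⟨0, by simp⟩, uniq := fun _ => Subsingleton.elim _ _ }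
    refine ⟨fun _ => x, ?_⟩
    rw [Fintype.sum_unique]
    simp
  | succ n ih =>
    intro x
    obtain ⟨c, hc⟩ := hb.span x
    choose a ha using fun r => ih (c r)
    refine ⟨fun i => a ((boxEquiv p e n i).1) ((boxEquiv p e n i).2), ?_⟩
    rw [sum_box_succ, hc]
    simp only [Equiv.apply_symm_apply, ← ha]

theorem IsPBasis.twistEval_surjective {b : Fin e → K} (hb : IsPBasis p b) (n : ℕ) :
    Function.Surjective (twistEval p n b) := by
  intro x
  obtain ⟨a, ha⟩ := hb.span_pow n x
  exact ⟨boxPoly a, by rw [twistEval_boxPoly, ha]⟩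

/-- The coefficient of `Y^j` of `f(H(b, Y))` only depends on `f(b)` if `j < p^n`. -/
theorem IsPBasis.coeff_twistLaw_congr [Algebra (ZMod p) K] {b : Fin e → K} (hb : IsPBasis p b)
    {n : ℕ} {f g : MvPolynomial (Fin e) K} (h : twistEval p n b f = twistEval p n b g)
    {j : Fin e →₀ ℕ} (hj : ∀ k, j k < p ^ n) :
    MvPolynomial.coeff j (twistLaw p n b f) = MvPolynomial.coeff j (twistLaw p n b g) := by
  -- The box remainder of `f - g` has twisted value `0` at `b`, so it vanishes by independence and
  -- `f - g` itself lies in the ideal.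
  obtain ⟨a, ha⟩ := exists_boxPoly_sub_mem b (pow_pos hp.out.pos n) (f - g)
  have h1 := twistEval_eq_of_sub_mem p n b ha
  rw [map_sub, h, sub_self, twistEval_boxPoly] at h1
  have h0 : a = 0 := hb.indep_pow n a h1.symm
  have h2 := coeff_eq_zero_of_mem (twistLaw_sub_mem p n b ha) hj
  rw [h0, map_sub, MvPolynomial.coeff_sub, MvPolynomial.coeff_sub] at h2
  have h3 : boxPoly (0 : (Fin e → Fin (p ^ n)) → K) = 0 := by simp [boxPoly]
  rwa [h3, map_zero, MvPolynomial.coeff_zero, sub_zero, sub_eq_zero] at h2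

/-- The relation `ψ_{j,n}`. -/
def Psi (p : ℕ) [Fact p.Prime] [Algebra (ZMod p) K] (b : Fin e → K) (j : Fin e →₀ ℕ) (n : ℕ)
    (x y : K) : Prop :=
  ∃ a : (Fin e → Fin (p ^ n)) → K, x = ∑ i, a i ^ p ^ n * ∏ k, b k ^ (i k : ℕ) ∧
    y = ∑ i, a i ^ p ^ n * MvPolynomial.aeval b
      (delta p e (Finsupp.equivFunOnFinite.symm fun k => (i k : ℕ)) j)

/-! ### The relations `ψ_{j,n}`: functionality and independence of `n` -/

variable [Algebra (ZMod p) K] {b : Fin e → K} (hb : IsPBasis p b)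

include hb

/-- Frees `ψ_{j,n}` from the restriction to exponents in the box: reduction to the box changes
neither the value at `b` nor the coefficient at `Y^j`. -/
theorem IsPBasis.psi_iff {j : Fin e →₀ ℕ} {n : ℕ} (hj : ∀ k, j k < p ^ n) (x y : K) :
    Psi p b j n x y ↔ ∃ f, twistEval p n b f = x ∧
      MvPolynomial.coeff j (twistLaw p n b f) = y := by
  constructor
  · rintro ⟨a, rfl, rfl⟩
    exact ⟨boxPoly a, twistEval_boxPoly p n b a, coeff_twistLaw_boxPoly p n b a j⟩
  · rintro ⟨f, rfl, rfl⟩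
    obtain ⟨a, ha⟩ := hb.span_pow n (twistEval p n b f)
    refine ⟨a, ha, ?_⟩
    rw [← coeff_twistLaw_boxPoly]
    exact hb.coeff_twistLaw_congr (by rw [ha, twistEval_boxPoly]) hj

theorem IsPBasis.exists_psi (j : Fin e →₀ ℕ) (n : ℕ) (x : K) : ∃ y, Psi p b j n x y := by
  obtain ⟨a, ha⟩ := hb.span_pow n x
  exact ⟨_, a, ha, rfl⟩

theorem IsPBasis.psi_unique {j : Fin e →₀ ℕ} {n : ℕ} (hj : ∀ k, j k < p ^ n) {x y z : K}
    (hy : Psi p b j n x y) (hz : Psi p b j n x z) : y = z := by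
  rw [hb.psi_iff hj] at hy hz
  obtain ⟨f, hf, rfl⟩ := hy
  obtain ⟨g, hg, rfl⟩ := hz
  exact hb.coeff_twistLaw_congr (hf.trans hg.symm) hj

/-- Applying Frobenius to the coefficients lowers the level by one. The exponents may then leave the
smaller box, which `psi_iff` allows. -/
theorem IsPBasis.psi_of_le {j : Fin e →₀ ℕ} {n m : ℕ} (hj : ∀ k, j k < p ^ n) (hnm : n ≤ m)
    {x y : K} (h : Psi p b j m x y) : Psi p b j n x y := by
  induction m, hnm using Nat.le_induction with
  | base => exact h
  | succ m hm ih =>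
    have hjm : ∀ k, j k < p ^ m := fun k => (hj k).trans_le (Nat.pow_le_pow_right hp.out.pos hm)
    have hjm' : ∀ k, j k < p ^ (m + 1) := fun k =>
      (hj k).trans_le (Nat.pow_le_pow_right hp.out.pos (hm.trans (Nat.le_succ m)))
    rw [hb.psi_iff hjm'] at h
    obtain ⟨f, hf, hf'⟩ := h
    refine ih ((hb.psi_iff hjm x y).2 ⟨MvPolynomial.map (frobenius K p) f, ?_, ?_⟩)
    · rw [← twistEval_succ, hf]
    · rw [← twistLaw_succ, hf']

theorem IsPBasis.psi_congr {j : Fin e →₀ ℕ} {n m : ℕ} (hn : ∀ k, j k < p ^ n)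
    (hm : ∀ k, j k < p ^ m) (x y : K) : Psi p b j n x y ↔ Psi p b j m x y := by
  have key : ∀ {n m : ℕ}, (∀ k, j k < p ^ n) → n ≤ m → (Psi p b j n x y ↔ Psi p b j m x y) := by
    intro n m hn hnm
    refine ⟨fun h => ?_, hb.psi_of_le hn hnm⟩
    -- For the upward direction, the value given by level `m` descends to level `n`, where
    -- uniqueness identifies it with `y`.
    obtain ⟨z, hz⟩ := hb.exists_psi j m x
    rwa [hb.psi_unique hn h (hb.psi_of_le hn hnm hz)]
  rcases le_total n m with h | h
  · exact key hn h
  · exact (key hm h).symm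

end PBasis

/-! ### `W_e`-derivations on fields with a `p`-basis -/

section Derivation

open MvPolynomial

variable (p : ℕ) [hp : Fact p.Prime] {e : ℕ} {K : Type*} [Field K]

/-- The axioms of a strict `W_e`-derivation. -/
structure IsStrictDerivation (D : (Fin e →₀ ℕ) → K → K) : Prop where
  zero : ∀ x, D 0 x = x
  add : ∀ j x y, D j (x + y) = D j x + D j y
  mul : ∀ j x y, D j (x * y) = ∑ q ∈ Finset.HasAntidiagonal.antidiagonal j, D q.1 x * D q.2 y
  iter : ∀ i j x, D i (D j x) =
    ∑ l ∈ (finite_iterCoeff p e i j).toFinset, ((iterCoeff p e i j l).val : K) * D l x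
  strict : ∀ x, (∀ k, D (Finsupp.single k 1) x = 0) ↔ ∃ y, x = y ^ p

variable {p}

theorem coeff_single_mul {A : Type*} [CommRing A] (k : Fin e) (u v : MvPolynomial (Fin e) A) :
    coeff (Finsupp.single k 1) (u * v) =
      coeff (Finsupp.single k 1) u * constantCoeff v +
        constantCoeff u * coeff (Finsupp.single k 1) v := by
  classical
  rw [coeff_mul, Finsupp.antidiagonal_single, Finset.sum_map, Finset.Nat.antidiagonal_succ]
  simp [constantCoeff_eq, add_comm]

/-- The value of a polynomial at a multiple of `ε`. -/
theorem aeval_inr (v : Fin e → K) (u : MvPolynomial (Fin e) K) :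
    aeval (fun k => (TrivSqZeroExt.inr (v k) : DualNumber K)) u =
      TrivSqZeroExt.inl (constantCoeff u) +
        TrivSqZeroExt.inr (∑ k, v k * coeff (Finsupp.single k 1) u) := by
  induction u using MvPolynomial.induction_on with
  | C c =>
    have : ∀ k : Fin e, coeff (Finsupp.single k 1) (C c : MvPolynomial (Fin e) K) = 0 := by
      intro k
      rw [coeff_C, if_neg]
      intro h
      simpa using congrArg Finsupp.degree h
    simp [this]
    rfl
  | add u w hu hw =>
    rw [map_add, hu, hw]
    ext <;> simp [mul_add, Finset.sum_add_distrib]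
  | mul_X u i hu =>
    rw [map_mul, hu, aeval_X]
    simp only [coeff_single_mul, constantCoeff_X, mul_zero, zero_add, map_mul]
    ext
    · simp
    · classical
      simp only [TrivSqZeroExt.snd_mul, TrivSqZeroExt.fst_add, TrivSqZeroExt.fst_inl,
        TrivSqZeroExt.fst_inr, TrivSqZeroExt.snd_inr, TrivSqZeroExt.snd_add,
        TrivSqZeroExt.snd_inl, MulOpposite.op_zero, zero_smul, add_zero, zero_add, smul_eq_mul]
      rw [Finset.sum_eq_single i]
      · simp [coeff_X, mul_comm]
      · intro k _ hk
        rw [coeff_X, if_neg, mul_zero, mul_zero]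
        intro h
        exact hk (Finsupp.single_left_injective one_ne_zero h).symm
      · simp

variable (p) in
/-- The Jacobian of `Y ↦ H(b, Y)` at `0`. -/
def lawJacobian (b : Fin e → K) : Matrix (Fin e) (Fin e) K :=
  fun k m => coeff (Finsupp.single k 1)
    (law p (fun i => C (b i)) (X : Fin e → MvPolynomial (Fin e) K) m)

/-- If `v` is in the kernel, then `H(b, εv) = b = H(b, 0)` over the dual numbers. Cancellation in
the group gives `εv = 0`. -/
theorem lawJacobian_isUnit [Algebra (ZMod p) K] (b : Fin e → K) : IsUnit (lawJacobian p b) := by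
  rw [← Matrix.vecMul_injective_iff_isUnit]
  refine (injective_iff_map_eq_zero (Matrix.vecMulLinear (lawJacobian p b))).2 fun v hv => ?_
  have hv' : ∀ m, ∑ k, v k * coeff (Finsupp.single k 1)
      (law p (fun i => C (b i)) (X : Fin e → MvPolynomial (Fin e) K) m) = 0 := congrFun hv
  have h : law p (fun i => (TrivSqZeroExt.inl (b i) : DualNumber K))
      (fun i => TrivSqZeroExt.inr (v i)) =
      law p (fun i => TrivSqZeroExt.inl (b i)) (fun _ => 0) := by
    funext m
    have h1 := map_law p (aeval (fun k => (TrivSqZeroExt.inr (v k) : DualNumber K)) :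
      MvPolynomial (Fin e) K →ₐ[K] DualNumber K).toRingHom (fun i => C (b i)) X m
    have h2 : ∀ i, (aeval (fun k => (TrivSqZeroExt.inr (v k) : DualNumber K)) :
      MvPolynomial (Fin e) K →ₐ[K] DualNumber K).toRingHom (C (b i)) =
        TrivSqZeroExt.inl (b i) := fun i => algHom_C _ _
    have h3 : ∀ i, (aeval (fun k => (TrivSqZeroExt.inr (v k) : DualNumber K)) :
      MvPolynomial (Fin e) K →ₐ[K] DualNumber K).toRingHom (X i) =
        TrivSqZeroExt.inr (v i) := fun i => aeval_X _ _
    simp only [h2, h3] at h1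
    rw [law_zero_right, ← h1]
    refine (aeval_inr v _).trans ?_
    rw [hv' m, TrivSqZeroExt.inr_zero, add_zero, map_law]
    simp only [constantCoeff_C, constantCoeff_X]
    rw [law_zero_right]
  funext k
  simpa using congrArg TrivSqZeroExt.snd (congrFun (law_left_cancel p h) k)

variable [CharP K p]

/-- The chain rule for `f(H(b, Y))` at `Y = 0`, the twisted coefficients of `f` being constants. -/
theorem coeff_single_twistLaw [Algebra (ZMod p) K] (n : ℕ) (b : Fin e → K) (k : Fin e)
    (f : MvPolynomial (Fin e) K) :
    coeff (Finsupp.single k 1) (twistLaw p n b f) =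
      ∑ m, lawJacobian p b k m * twistEval p n b (pderiv m f) := by
  classical
  induction f using MvPolynomial.induction_on with
  | C c =>
    have : coeff (Finsupp.single k 1) (C (c ^ p ^ n) : MvPolynomial (Fin e) K) = 0 := by
      rw [coeff_C, if_neg]
      intro h
      simpa using congrArg Finsupp.degree h
    rw [twistLaw_C, this]
    simp
  | add f g hf hg => simp only [map_add, coeff_add, hf, hg, mul_add, Finset.sum_add_distrib]
  | mul_X f i hf =>
    rw [map_mul, coeff_single_mul, hf, constantCoeff_twistLaw, constantCoeff_twistLaw, twistEval_X,
      twistLaw_X]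
    simp only [Derivation.leibniz, smul_eq_mul, map_add, map_mul, twistEval_X, mul_add,
      Finset.sum_add_distrib]
    rw [add_comm, Finset.sum_mul]
    congr 1
    · rw [Finset.sum_eq_single i]
      · rw [pderiv_X_self, map_one, mul_one, mul_comm]
        rfl
      · intro m _ hm
        rw [pderiv_X_of_ne hm.symm, map_zero, mul_zero, mul_zero]
      · simp
    · exact Finset.sum_congr rfl fun m _ => by ring

variable [Algebra (ZMod p) K] {b : Fin e → K} (hb : IsPBasis p b)
  {D : (Fin e →₀ ℕ) → K → K}

omit [CharP K p] in
theorem zmod_val_cast (c : ZMod p) : ((c.val : ℕ) : K) = algebraMap (ZMod p) K c := by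
  rw [← map_natCast (algebraMap (ZMod p) K), ZMod.natCast_zmod_val]

/-- A family of maps compatible with the homomorphisms `f ↦ f(H(b, Y))`. -/
def IsTwistCompatible (b : Fin e → K) (D : (Fin e →₀ ℕ) → K → K) : Prop :=
  ∀ (j : Fin e →₀ ℕ) (n : ℕ), (∀ k, j k ≤ n) → ∀ f : MvPolynomial (Fin e) K,
    D j (twistEval p n b f) = coeff j (twistLaw p n b f)

-- The bound `j_k ≤ n` enters only through `n < p^n`, which makes `ψ_{j,n}` functional.
include hb in
theorem IsPBasis.isTwistCompatible_iff : IsTwistCompatible (p := p) b D ↔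
    ∀ (j : Fin e →₀ ℕ) (n : ℕ), (∀ k, j k ≤ n) → ∀ x y, D j x = y ↔ Psi p b j n x y := by
  have hlt : ∀ {j : Fin e →₀ ℕ} {n : ℕ}, (∀ k, j k ≤ n) → ∀ k, j k < p ^ n :=
    fun h k => (h k).trans_lt (Nat.lt_pow_self hp.out.one_lt)
  constructor
  · intro hD j n hj x y
    rw [hb.psi_iff (hlt hj)]
    constructor
    · rintro rfl
      obtain ⟨f, rfl⟩ := hb.twistEval_surjective n x
      exact ⟨f, rfl, (hD j n hj f).symm⟩
    · rintro ⟨f, rfl, rfl⟩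
      exact hD j n hj f
  · intro hD j n hj f
    rw [hD j n hj, hb.psi_iff (hlt hj)]
    exact ⟨f, rfl, rfl⟩

theorem IsTwistCompatible.apply_aeval (hD : IsTwistCompatible (p := p) b D) (j : Fin e →₀ ℕ)
    (P : MvPolynomial (Fin e) (ZMod p)) : D j (aeval b P) = aeval b (dPoly p e j P) := by
  rw [← twistEval_map p j.degree, hD j _ (fun k => Finsupp.le_degree k j), coeff_twistLaw_map]

include hb

/-- Level `n = 1` suffices for first-order indices. By the chain rule and the invertible Jacobian,
the first-order operators vanish at `x` exactly when all `∂f/∂X_m` have twisted value `0`. -/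
theorem IsPBasis.strict_of_isTwistCompatible (hD : IsTwistCompatible (p := p) b D) (x : K) :
    (∀ k, D (Finsupp.single k 1) x = 0) ↔ ∃ y, x = y ^ p := by
  classical
  have h1 : ∀ k i : Fin e, Finsupp.single k 1 i ≤ 1 := fun k i => by
    rw [Finsupp.single_apply]
    split_ifs <;> simp
  constructor
  · intro hx
    obtain ⟨a, ha⟩ := hb.span_pow 1 x
    rw [← twistEval_boxPoly] at ha
    set f := boxPoly a with hf
    have h2 : ∀ m, twistEval p 1 b (pderiv m f) = 0 := by
      refine congrFun (f := fun m => twistEval p 1 b (pderiv m f)) ?_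
      refine (Matrix.mulVec_injective_of_isUnit (lawJacobian_isUnit (p := p) b)) ?_
      refine Eq.trans ?_ (Matrix.mulVec_zero _).symm
      funext k
      have := hx k
      rw [ha, hD _ 1 (h1 k), coeff_single_twistLaw] at this
      exact this
    -- `X_m ∂_m` multiplies the coefficient `a_i` by `i_m` and keeps exponents in the box, so
    -- independence applies. As `0 < i_m < p` makes `i_m` invertible, only `a_0` survives and `x =
    -- a_0^p`.
    have h3 : ∀ m (i : Fin e → Fin (p ^ 1)), a i * (i m : ℕ) = 0 := by
      intro m
      refine congrFun (f := fun i => a i * ((i m : ℕ) : K)) (hb.indep_pow 1 _ ?_)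
      rw [← twistEval_boxPoly]
      have h4 : boxPoly (fun i : Fin e → Fin (p ^ 1) => a i * ((i m : ℕ) : K)) =
          X m * pderiv m f := by
        rw [hf, boxPoly, boxPoly, map_sum, Finset.mul_sum]
        refine Finset.sum_congr rfl fun i _ => ?_
        rw [X_mul_pderiv_monomial, Finsupp.equivFunOnFinite_symm_apply_apply, ← map_nsmul,
          nsmul_eq_mul, mul_comm]
      rw [h4, map_mul, h2, mul_zero]
    have hpos : 0 < p ^ 1 := by simpa using hp.out.pos
    refine ⟨a fun _ => ⟨0, hpos⟩, ?_⟩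
    rw [ha, twistEval_boxPoly, Finset.sum_eq_single fun _ => ⟨0, hpos⟩]
    · simp
    · intro i _ hi
      obtain ⟨m, hm⟩ := Function.ne_iff.1 hi
      have hm0 : (i m : ℕ) ≠ 0 := fun h => hm (Fin.ext h)
      have : ((i m : ℕ) : K) ≠ 0 := by
        rw [Ne, CharP.cast_eq_zero_iff K p]
        intro hdvd
        have := (i m).2.trans_eq (pow_one p)
        exact absurd (Nat.le_of_dvd (Nat.pos_of_ne_zero hm0) hdvd) (not_le.2 this)
      rw [(mul_eq_zero.1 (h3 m i)).resolve_right this, zero_pow (pow_ne_zero _ hp.out.ne_zero),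
        zero_mul]
    · simp
  · rintro ⟨y, rfl⟩ k
    have h2 : twistEval p 1 b (C y) = y ^ p := by rw [twistEval_C, pow_one]
    rw [← h2, hD _ 1 (h1 k), coeff_single_twistLaw]
    simp

/-- The `ψ_{j,n}` define a strict `W_e`-derivation extending the canonical one. -/
theorem IsPBasis.isStrictDerivation (hD : IsTwistCompatible (p := p) b D) :
    IsStrictDerivation p D where
  zero x := by
    obtain ⟨f, rfl⟩ := hb.twistEval_surjective 0 x
    rw [hD 0 0 (fun k => by simp), ← constantCoeff_eq, constantCoeff_twistLaw]
  add j x y := by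
    obtain ⟨f, rfl⟩ := hb.twistEval_surjective j.degree x
    obtain ⟨g, rfl⟩ := hb.twistEval_surjective j.degree y
    have h := hD j j.degree fun k => Finsupp.le_degree k j
    rw [← map_add, h, h, h, map_add, coeff_add]
  mul j x y := by
    classical
    obtain ⟨f, rfl⟩ := hb.twistEval_surjective j.degree x
    obtain ⟨g, rfl⟩ := hb.twistEval_surjective j.degree y
    rw [← map_mul, hD j j.degree fun k => Finsupp.le_degree k j, map_mul, coeff_mul]
    refine Finset.sum_congr rfl fun q hq => ?_
    rw [Finset.HasAntidiagonal.mem_antidiagonal] at hq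
    rw [hD q.1 j.degree, hD q.2 j.degree]
    · intro k
      refine le_trans ?_ (Finsupp.le_degree k j)
      rw [← hq]
      exact Nat.le_add_left _ _
    · intro k
      refine le_trans ?_ (Finsupp.le_degree k j)
      rw [← hq]
      exact Nat.le_add_right _ _
  iter i j x := by
    -- One level serving `i`, `j` and every `l` with a nonzero structure constant, by
    -- `iterCoeff_eq_zero`.
    set n := i.degree + j.degree with hn
    obtain ⟨f, rfl⟩ := hb.twistEval_surjective n x
    have hi : ∀ k, i k ≤ n := fun k => (Finsupp.le_degree k i).trans (Nat.le_add_right _ _)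
    have hj : ∀ k, j k ≤ n := fun k => (Finsupp.le_degree k j).trans (Nat.le_add_left _ _)
    have hl : ∀ l ∈ (finite_iterCoeff p e i j).toFinset, ∀ k, l k ≤ n := by
      intro l hl k
      rw [Set.Finite.mem_toFinset, Set.mem_ofPred_eq] at hl
      refine (Finsupp.le_degree k l).trans ?_
      by_contra h
      exact hl (iterCoeff_eq_zero p e i j l (not_le.1 h))
    rw [hD j n hj, Finset.sum_congr rfl fun l h => by rw [hD l n (hl l h), zmod_val_cast] ]
    induction f using MvPolynomial.induction_on' with
    | add f g hf hg =>
      -- The values of `D_j` are written as twisted values again, so that `D_i` can be applied to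
      -- their sum.
      obtain ⟨f', hf'⟩ := hb.twistEval_surjective n (coeff j (twistLaw p n b f))
      obtain ⟨g', hg'⟩ := hb.twistEval_surjective n (coeff j (twistLaw p n b g))
      rw [map_add, coeff_add, ← hf', ← hg', ← map_add, hD i n hi, map_add, coeff_add,
        ← hD i n hi f', ← hD i n hi g', hf', hg', hf, hg, ← Finset.sum_add_distrib]
      exact Finset.sum_congr rfl fun l _ => by rw [coeff_add, mul_add]
    | monomial m c =>
      -- The factor `c^(p^n)` passes through both operators, which leaves iterativity of the
      -- canonical derivation, `dPoly_dPoly`.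
      have h1 : c ^ p ^ n * aeval b (delta p e m j) =
          twistEval p n b (C c * map (algebraMap (ZMod p) K) (delta p e m j)) := by
        rw [map_mul, twistEval_C, twistEval_map]
      rw [coeff_twistLaw_monomial, h1, hD i n hi, map_mul, twistLaw_C, coeff_C_mul,
        coeff_twistLaw_map, delta, dPoly_dPoly, map_sum, Finset.mul_sum]
      refine Finset.sum_congr rfl fun l _ => ?_
      rw [map_smul, coeff_twistLaw_monomial, Algebra.smul_def, delta]
      ring
  strict := hb.strict_of_isTwistCompatible hD

end Derivation

/-! ### Derivations as homomorphisms to power series -/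

section Hom

variable {p : ℕ} [hp : Fact p.Prime] {e : ℕ} {K : Type*} [Field K] [Algebra (ZMod p) K]
  {b : Fin e → K} {D : (Fin e →₀ ℕ) → K → K}

theorem delta_zero (j : Fin e →₀ ℕ) :
    delta p e 0 j = MvPowerSeries.coeff j (1 : MvPowerSeries (Fin e) _) := by
  rw [delta, dPoly, ← map_one (evH p e)]
  rfl

/-- The ring homomorphism `x ↦ ∑ D_j(x) Y^j`. -/
def IsStrictDerivation.toHom (hD : IsStrictDerivation p D)
    (hbD : ∀ i j : Fin e →₀ ℕ,
      D j (∏ k, b k ^ i k) = MvPolynomial.aeval b (delta p e i j)) :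
    K →+* MvPowerSeries (Fin e) K where
  toFun x j := D j x
  map_one' := by
    classical
    ext j
    -- The empty monomial in `b` is `1`, so its prescribed value is that of `D_j(1)`.
    have h := hbD 0 j
    rw [delta_zero, MvPowerSeries.coeff_one] at h
    have h1 : D j 1 = if j = 0 then 1 else 0 := by simpa [apply_ite] using h
    refine Eq.trans h1 ?_
    rw [MvPowerSeries.coeff_one]
  map_zero' := by
    ext j
    have h := hD.add j 0 0
    rw [add_zero] at h
    exact left_eq_add.1 h
  map_add' x y := by
    ext j
    exact hD.add j x y
  map_mul' x y := by
    classical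
    ext j
    exact (hD.mul j x y).trans (MvPowerSeries.coeff_mul (R := K) (n := j)
      (φ := fun j => D j x) (ψ := fun j => D j y)).symm

variable (hD : IsStrictDerivation p D) (hbD : ∀ i j : Fin e →₀ ℕ,
      D j (∏ k, b k ^ i k) = MvPolynomial.aeval b (delta p e i j))

theorem IsStrictDerivation.coeff_toHom (j : Fin e →₀ ℕ) (x : K) :
    MvPowerSeries.coeff j (hD.toHom hbD x) = D j x := rfl

include hD hbD

/-- The `p^n`-th power of the series `∑ D_j(x) Y^j` involves only exponents divisible by `p^n`. -/
theorem IsStrictDerivation.apply_pow [CharP K p] {n : ℕ} {j : Fin e →₀ ℕ}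
    (hj : ∀ k, j k < p ^ n) (x : K) : D j (x ^ p ^ n) = if j = 0 then x ^ p ^ n else 0 := by
  split_ifs with h
  · rw [h, hD.zero]
  · obtain ⟨k, hk⟩ := Finsupp.ne_iff.1 h
    rw [← hD.coeff_toHom hbD, map_pow,
      ← MvPowerSeries.map_iterateFrobenius_expand p hp.out.ne_zero, MvPowerSeries.coeff_map,
      MvPowerSeries.coeff_expand_of_not_dvd (i := k), map_zero]
    exact fun hdvd => absurd (Nat.le_of_dvd (Nat.pos_of_ne_zero hk) hdvd) (not_le.2 (hj k))

/-- A `W_e`-derivation extending the canonical one is determined by the `p`-basis. -/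
theorem IsStrictDerivation.isTwistCompatible [CharP K p] :
    IsTwistCompatible (p := p) b D := by
  classical
  intro j n hj f
  have hadd : ∀ x y, D j (x + y) = D j x + D j y := hD.add j
  induction f using MvPolynomial.induction_on' with
  | add f g hf hg => rw [map_add, hadd, map_add, MvPolynomial.coeff_add, hf, hg]
  | monomial m c =>
    have h1 : twistEval p n b (MvPolynomial.monomial m c) = c ^ p ^ n * ∏ k, b k ^ m k := by
      rw [MvPolynomial.monomial_eq, map_mul, twistEval_C,
        Finsupp.prod_fintype _ _ (fun _ => pow_zero _), map_prod]
      simp [twistEval_X]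
    -- In the Leibniz sum for `c^(p^n) b^m` only the index `(0, j)` contributes, by `apply_pow`.
    rw [h1, hD.mul, coeff_twistLaw_monomial, Finset.sum_eq_single (0, j)]
    · rw [hD.zero, hbD]
    · intro q hq hne
      rw [Finset.HasAntidiagonal.mem_antidiagonal] at hq
      rw [hD.apply_pow hbD, if_neg, zero_mul]
      · intro h0
        rw [h0, zero_add] at hq
        exact hne (Prod.ext h0 hq)
      · intro k
        refine lt_of_le_of_lt ?_ ((hj k).trans_lt (Nat.lt_pow_self hp.out.one_lt))
        rw [← hq]
        exact Nat.le_add_right _ _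
    · intro h
      exact absurd (Finset.HasAntidiagonal.mem_antidiagonal.2 (zero_add j)) h

end Hom

/-! ### The canonical basis -/

section CanonicalBasis

variable {p : ℕ} [hp : Fact p.Prime] {e : ℕ} {K : Type*} [Field K] [Algebra (ZMod p) K]
  [CharP K p] {b : Fin e → K} (hb : IsPBasis p b)

include hb

/-- Elements of `𝔽_p` are their own `p^n`-th powers. So a relation `P(b) = 0` is a relation over
`K^(p^n)` among monomials with exponents below `p^n`, once `n` is large. -/
theorem IsPBasis.aeval_injective :
    Function.Injective (MvPolynomial.aeval b : MvPolynomial (Fin e) (ZMod p) →ₐ[ZMod p] K) := by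
  classical
  rw [injective_iff_map_eq_zero]
  intro P hP
  obtain ⟨n, hn⟩ : ∃ n, ∀ m ∈ P.support, ∀ k, m k < p ^ n := by
    refine ⟨P.totalDegree, fun m hm k => ?_⟩
    exact ((Finsupp.le_degree k m).trans (MvPolynomial.le_totalDegree hm)).trans_lt
      (Nat.lt_pow_self hp.out.one_lt)
  have h0 : (fun i : Fin e → Fin (p ^ n) => algebraMap (ZMod p) K
      (P.coeff (Finsupp.equivFunOnFinite.symm fun k => (i k : ℕ)))) = 0 := by
    refine hb.indep_pow n _ ?_
    rw [← hP, MvPolynomial.aeval_def, MvPolynomial.eval₂_eq']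
    symm
    refine Finset.sum_bij_ne_zero (fun m hm _ k => ⟨m k, hn m hm k⟩) (fun _ _ _ => Finset.mem_univ _)
      ?_ ?_ ?_
    · intro m hm _ m' hm' _ h
      ext k
      exact congrArg Fin.val (congrFun h k)
    · intro i _ hi
      refine ⟨Finsupp.equivFunOnFinite.symm fun k => (i k : ℕ), ?_, ?_, rfl⟩
      · rw [MvPolynomial.mem_support_iff]
        intro h
        apply hi
        rw [h, map_zero, zero_pow (pow_ne_zero _ hp.out.ne_zero), zero_mul]
      · intro h
        apply hi
        rw [← map_pow, ZMod.pow_card_pow]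
        exact h
    · intro m hm _
      rw [← map_pow, ZMod.pow_card_pow]
      congr 3
      ext k
      rfl
  ext m
  by_contra hm
  have hm' : m ∈ P.support := MvPolynomial.mem_support_iff.2 hm
  have h1 := congrFun h0 fun k => ⟨m k, hn m hm' k⟩
  have h2 : (Finsupp.equivFunOnFinite.symm fun k => m k) = m := Finsupp.ext fun k => rfl
  simp only [h2, Pi.zero_apply] at h1
  exact hm ((map_eq_zero _).1 h1)

theorem IsPBasis.injective : Function.Injective b := by
  intro k l h
  have := hb.aeval_injective (p := p) (a₁ := MvPolynomial.X k) (a₂ := MvPolynomial.X l)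
    (by simpa using h)
  exact MvPolynomial.X_injective this

/-- By strictness the constants are `K^p`, so `K^p(C_K) = K^p` and only a reindexing of the
monomials separates this from `indep`. -/
theorem IsPBasis.isPIndependent {D : (Fin e →₀ ℕ) → K → K}
    (hD : ∀ x, (∀ k, D (Finsupp.single k 1) x = 0) ↔ ∃ y, x = y ^ p) :
    IsPIndependent p (constants D) (Set.range b) := by
  classical
  have hC : constants D = Set.range fun x : K => x ^ p := by
    ext x
    exact (hD x).trans ⟨fun ⟨y, hy⟩ => ⟨y, hy.symm⟩, fun ⟨y, hy⟩ => ⟨y, hy.symm⟩⟩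
  have hS : Subfield.closure (Set.range (fun x : K => x ^ p) ∪ constants D) =
      (frobenius K p).fieldRange := by
    rw [hC, Set.union_self]
    apply le_antisymm
    · rw [Subfield.closure_le]
      rintro _ ⟨x, rfl⟩
      exact ⟨x, rfl⟩
    · rintro _ ⟨x, rfl⟩
      exact Subfield.subset_closure ⟨x, rfl⟩
  have hmem : ∀ c : Subfield.closure (Set.range (fun x : K => x ^ p) ∪ constants D),
      ∃ y : K, (c : K) = y ^ p := by
    intro c
    obtain ⟨y, hy⟩ : (c : K) ∈ (frobenius K p).fieldRange := hS ▸ c.2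
    exact ⟨y, hy.symm⟩
  let ε : Fin e ≃ Set.range b := Equiv.ofInjective b hb.injective
  have : Fintype (Set.range b) := Fintype.ofEquiv _ ε
  let E : (Fin e → Fin p) ≃ {m : Set.range b →₀ ℕ // ∀ b, m b < p} :=
    { toFun := fun i => ⟨Finsupp.equivFunOnFinite.symm fun x => (i (ε.symm x) : ℕ),
        fun x => (i (ε.symm x)).2⟩
      invFun := fun m k => ⟨m.1 (ε k), m.2 _⟩
      left_inv := fun i => by
        funext k
        simp
      right_inv := fun m => by
        ext x
        simp }
  rw [IsPIndependent, ← linearIndependent_equiv E, Fintype.linearIndependent_iff]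
  intro g hg
  choose a ha using fun i => hmem (g i)
  have h0 : a = 0 := by
    refine hb.indep a ?_
    rw [← hg]
    refine Finset.sum_congr rfl fun i _ => ?_
    rw [Subfield.smul_def, ha, smul_eq_mul, Function.comp_apply,
      Finsupp.prod_fintype _ _ (fun _ => pow_zero _), ← ε.prod_comp]
    simp [E, ε]
  intro i
  apply Subtype.ext
  rw [ha, h0]
  exact zero_pow hp.out.ne_zero

/-- The elements of the `p`-basis form a canonical `W_e`-basis. -/
theorem IsPBasis.isCanonicalBasis {D : (Fin e →₀ ℕ) → K → K} (hD : IsStrictDerivation p D)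
    (hbD : ∀ i j : Fin e →₀ ℕ,
      D j (∏ k, b k ^ i k) = MvPolynomial.aeval b (delta p e i j)) :
    IsCanonicalBasis p D (Set.range b) where
  finite := Set.finite_range b
  ncard_eq := by
    rw [← Set.image_univ, Set.ncard_image_of_injective _ hb.injective, Set.ncard_univ,
      Nat.card_eq_fintype_card, Fintype.card_fin]
  pIndependent := hb.isPIndependent hD.strict
  exists_embedding := by
    have htw := hD.isTwistCompatible hbD
    have hunit : ∀ f : nonZeroDivisors (MvPolynomial (Fin e) (ZMod p)),
        IsUnit ((MvPolynomial.aeval b : _ →ₐ[ZMod p] K).toRingHom f) := fun f =>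
      isUnit_iff_ne_zero.2 fun h => nonZeroDivisors.coe_ne_zero f
        (hb.aeval_injective (p := p) (h.trans (map_zero _).symm))
    let φ : RatFun p e →+* K := IsLocalization.lift hunit
    have hφ : ∀ P, φ (algebraMap (MvPolynomial (Fin e) (ZMod p)) (RatFun p e) P) =
        MvPolynomial.aeval b P := fun P => IsLocalization.lift_eq hunit P
    refine ⟨φ, ?_, ?_⟩
    -- Two ring homomorphisms on a fraction field agree if they agree on polynomials, where
    -- `apply_aeval` applies.
    · have h : (MvPowerSeries.map φ).comp (canonicalHom p e) = (hD.toHom hbD).comp φ := by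
        refine IsLocalization.ringHom_ext (nonZeroDivisors (MvPolynomial (Fin e) (ZMod p)))
          (RingHom.ext fun P => MvPowerSeries.ext fun j => ?_)
        simp only [RingHom.comp_apply, MvPowerSeries.coeff_map]
        refine (congrArg φ (dFrac_algebraMap p e j P)).trans ?_
        rw [hφ, hD.coeff_toHom hbD, hφ, htw.apply_aeval]
      intro j f
      exact congrArg (MvPowerSeries.coeff j) (RingHom.congr_fun h f)
    · rw [← Set.range_comp]
      congr 1
      funext k
      rw [Function.comp_apply, hφ, MvPolynomial.aeval_X]

end CanonicalBasis

/-! ### Semantics in the language of rings -/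

section Semantics

theorem realize_close {L : Language} {V : Type} [Finite V] {M : Type*} [L.Structure M]
    (φ : L.Formula V) : M ⊨ close φ ↔ ∀ v : V → M, φ.Realize v := by
  rw [Sentence.Realize, close, Formula.realize_iAlls]
  refine forall_congr' fun v => ?_
  rw [Formula.realize_relabel]
  rfl

theorem forall_unit {K : Type*} {P : (Unit → K) → Prop} : (∀ v, P v) ↔ ∀ x : K, P fun _ => x :=
  ⟨fun h _ => h _, fun h v => h (v ())⟩

theorem forall_fin_two {K : Type*} {P : (Fin 2 → K) → Prop} : (∀ v, P v) ↔ ∀ x y, P ![x, y] := by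
  refine ⟨fun h x y => h _, fun h v => ?_⟩
  have := h (v 0) (v 1)
  rwa [show ![v 0, v 1] = v by ext i; fin_cases i <;> rfl] at this

theorem model_range_iff {L : Language} {ι M : Type*} [L.Structure M] (f : ι → L.Sentence) :
    M ⊨ Set.range f ↔ ∀ i, M ⊨ f i := by
  rw [Theory.model_iff, Set.forall_mem_range]

theorem lift_map {V W R : Type*} [CommRing R] (f : V → W) (v : W → R) (P : FreeCommRing V) :
    FreeCommRing.lift v (FreeCommRing.map f P) = FreeCommRing.lift (v ∘ f) P := by
  refine RingHom.congr_fun (f := (FreeCommRing.lift v).comp (FreeCommRing.map f))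
    (FreeCommRing.hom_ext fun x => ?_) P
  simp

variable {K : Type*} [Field K] [CompatibleRing K]

theorem realize_eqn {V : Type} (P Q : FreeCommRing V) (v : V → K) :
    (eqn P Q).Realize v ↔ FreeCommRing.lift v P = FreeCommRing.lift v Q := by
  simp [eqn]

theorem realize_linIndepFormula {ι V : Type} [Fintype ι] (p : ℕ) (c : ι → FreeCommRing V)
    (v : V → K) : (linIndepFormula p c).Realize v ↔
      ∀ x : ι → K, ∑ i, x i ^ p * FreeCommRing.lift v (c i) = 0 → x = 0 := by
  rw [linIndepFormula, Formula.realize_iAlls]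
  refine forall_congr' fun x => ?_
  simp only [Formula.realize_imp, Formula.realize_iInf, realize_eqn, map_sum, map_mul, map_pow,
    lift_map, FreeCommRing.lift_of, map_zero, funext_iff]
  rfl

theorem realize_spanFormula {ι V : Type} [Fintype ι] (p : ℕ) (c : ι → FreeCommRing V)
    (v : V → K) : (spanFormula p c).Realize v ↔
      ∀ y : K, ∃ x : ι → K, y = ∑ i, x i ^ p * FreeCommRing.lift v (c i) := by
  rw [spanFormula, Formula.realize_iAlls]
  simp only [Formula.realize_iExs, realize_eqn, map_sum, map_mul, map_pow,
    lift_map, FreeCommRing.lift_of]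
  exact (Equiv.funUnique Unit K).forall_congr fun {y} => Iff.rfl

theorem charP_of_model_SCF (p e : ℕ) (h : K ⊨ SCF p e) : CharP K p := by
  rw [SCF, Theory.model_union_iff, Theory.model_union_iff] at h
  exact Field.charP_iff_model_fieldOfChar.1 h.1.1

theorem exists_basis_of_model_SCF {p e : ℕ} (h : K ⊨ SCF p e) :
    ∃ c : (Fin e → Fin p) → K, (∀ x : (Fin e → Fin p) → K, ∑ i, x i ^ p * c i = 0 → x = 0) ∧
      ∀ y, ∃ x : (Fin e → Fin p) → K, y = ∑ i, x i ^ p * c i := by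
  rw [SCF, Theory.model_union_iff, Theory.model_singleton_iff] at h
  have h2 := h.2
  rw [Sentence.Realize, imperfectionAxiom, Formula.realize_iExs] at h2
  obtain ⟨c, hc⟩ := h2
  rw [Formula.realize_inf, realize_linIndepFormula, realize_spanFormula] at hc
  simp only [FreeCommRing.lift_of, Sum.elim_inr] at hc
  exact ⟨c, hc⟩

theorem realize_alpha (p e : ℕ) (b : Fin e → K) : (alpha p e).Realize b ↔
    ∀ a : (Fin e → Fin p) → K, ∑ i, a i ^ p * ∏ k, b k ^ (i k : ℕ) = 0 → a = 0 := by
  rw [alpha, realize_linIndepFormula]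
  simp

/-- A linearly independent family of `p^e` elements is a basis of `K` over `K^p`. -/
theorem isPBasis_of_model {p e : ℕ} [hp : Fact p.Prime] (h : K ⊨ SCF p e) (b : Fin e → K)
    (hα : (alpha p e).Realize b) : IsPBasis p b := by
  have hchar := charP_of_model_SCF p e h
  rw [realize_alpha] at hα
  refine ⟨hα, ?_⟩
  obtain ⟨c, hc, hs⟩ := exists_basis_of_model_SCF h
  let F := (frobenius K p).fieldRange
  have hF : ∀ x : K, x ^ p ∈ F := fun x => ⟨x, rfl⟩
  have hF' : ∀ f : F, ∃ x : K, (f : K) = x ^ p := fun f => by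
    obtain ⟨x, hx⟩ := f.2
    exact ⟨x, hx.symm⟩
  have hli : ∀ d : (Fin e → Fin p) → K,
      (∀ x : (Fin e → Fin p) → K, ∑ i, x i ^ p * d i = 0 → x = 0) → LinearIndependent F d := by
    intro d hd
    rw [Fintype.linearIndependent_iff]
    intro g hg i
    choose x hx using fun i => hF' (g i)
    have h0 : x = 0 := hd x (by simpa only [Subfield.smul_def, hx, smul_eq_mul] using hg)
    apply Subtype.ext
    rw [hx, h0]
    exact zero_pow hp.out.ne_zero
  have hspan : ⊤ ≤ Submodule.span F (Set.range c) := by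
    intro y _
    obtain ⟨x, hx⟩ := hs y
    rw [Submodule.mem_span_range_iff_exists_fun]
    exact ⟨fun i => ⟨x i ^ p, hF _⟩, hx.symm⟩
  -- The imperfection axiom supplies some basis indexed by `[p]^e`; an independent family with the
  -- same index set must span.
  have hrank := Module.finrank_eq_card_basis (Module.Basis.mk (hli c hc) hspan)
  have htop := (hli (fun i => ∏ k, b k ^ (i k : ℕ)) hα).span_eq_top_of_card_eq_finrank hrank.symm
  intro y
  have hy : y ∈ Submodule.span F (Set.range fun i : Fin e → Fin p => ∏ k, b k ^ (i k : ℕ)) := by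
    rw [htop]
    trivial
  rw [Submodule.mem_span_range_iff_exists_fun] at hy
  obtain ⟨g, hg⟩ := hy
  choose x hx using fun i => hF' (g i)
  exact ⟨x, by simpa only [Subfield.smul_def, hx, smul_eq_mul] using hg.symm⟩

/-- Formulas carry coefficients as natural numbers below `p`; cast into an `𝔽_p`-algebra, these are
the original coefficients. -/
theorem lift_liftAt (p e : ℕ) [Fact p.Prime] {V R : Type*} [CommRing R] [Algebra (ZMod p) R]
    (v : V → R) (t : Fin e → FreeCommRing V) (P : MvPolynomial (Fin e) (ZMod p)) :
    FreeCommRing.lift v (liftAt p e t P) =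
      MvPolynomial.aeval (fun k => FreeCommRing.lift v (t k)) P := by
  rw [liftAt, MvPolynomial.aeval_def, MvPolynomial.eval₂_eq', map_sum]
  refine Finset.sum_congr rfl fun m _ => ?_
  rw [map_mul, map_prod, map_natCast, ← map_natCast (algebraMap (ZMod p) R), ZMod.natCast_zmod_val]
  simp only [map_pow]

theorem realize_defFormula (p e : ℕ) [Fact p.Prime] [CharP K p] [Algebra (ZMod p) K]
    [(LZeroB e).Structure K] [(Language.ring.lhomWithConstants (Fin e)).IsExpansionOn K]
    (j : Fin e →₀ ℕ) (n : ℕ) (v : Unit ⊕ Unit → K) :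
    (defFormula p e j n).Realize v ↔
      Psi p (fun k => (Language.ring.con k : K)) j n (v (Sum.inl ())) (v (Sum.inr ())) := by
  rw [defFormula, Formula.Realize, ← BoundedFormula.realize_constantsVarsEquiv,
    Equiv.apply_symm_apply]
  refine (Formula.realize_iExs (L := Language.ring)).trans (exists_congr fun a => ?_)
  rw [Formula.realize_inf, realize_eqn, realize_eqn]
  simp [lift_liftAt]

end Semantics

/-! ### Semantics in the language of `W_e`-derivations -/

section StarSemantics

variable {e : ℕ} {K : Type*} [Field K] [CompatibleRing K] [(LStar e).Structure K]
  [(ringToStar e).IsExpansionOn K]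

variable (K) in
/-- The interpretation of `D_j`. -/
def opD (j : Fin e →₀ ℕ) (x : K) : K :=
  Structure.funMap (L := LStar e) (Sum.inr (HSFunc.D j)) ![x]

theorem realize_dTerm {K : Type*} [(LStar e).Structure K] {V : Type} (j : Fin e →₀ ℕ)
    (t : (LStar e).Term V) (v : V → K) :
    (dTerm j t).realize v = opD K j (t.realize v) :=
  Term.realize_functions_apply₁

theorem realize_polyAt {V W : Type} (P : FreeCommRing W) (t : W → (LStar e).Term V) (v : V → K) :
    (polyAt P t).realize v = FreeCommRing.lift (fun w => (t w).realize v) P := by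
  rw [polyAt, Term.realize_subst, LHom.realize_onTerm, realize_termOfFreeCommRing]

theorem model_WeDCF_iff (p : ℕ) [Fact p.Prime] :
    K ⊨ WeDCF p e ↔ K ⊨ SCF p e ∧ IsStrictDerivation p (opD K (e := e)) := by
  simp only [WeDCF, Theory.model_union_iff, Theory.model_singleton_iff, LHom.onTheory_model]
  have h1 : K ⊨ zeroAxiom e ↔ ∀ x, opD K (0 : Fin e →₀ ℕ) x = x := by
    rw [zeroAxiom, realize_close, forall_unit]
    simp [realize_dTerm]
  have h2 : K ⊨ Set.range (addAxiom e) ↔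
      ∀ (j : Fin e →₀ ℕ) x y, opD K j (x + y) = opD K j x + opD K j y := by
    rw [model_range_iff]
    refine forall_congr' fun j => ?_
    rw [addAxiom, realize_close, forall_fin_two]
    simp [realize_dTerm, realize_polyAt]
  have h3 : K ⊨ Set.range (mulAxiom e) ↔ ∀ (j : Fin e →₀ ℕ) x y, opD K j (x * y) =
      ∑ q ∈ Finset.HasAntidiagonal.antidiagonal j, opD K q.1 x * opD K q.2 y := by
    rw [model_range_iff]
    refine forall_congr' fun j => ?_
    rw [mulAxiom, realize_close, forall_fin_two]
    simp [realize_dTerm, realize_polyAt]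
  have h4 : K ⊨ Set.range (fun q : (Fin e →₀ ℕ) × (Fin e →₀ ℕ) => iterAxiom p e q.1 q.2) ↔
      ∀ (i j : Fin e →₀ ℕ) x, opD K i (opD K j x) =
        ∑ l ∈ (finite_iterCoeff p e i j).toFinset,
          ((iterCoeff p e i j l).val : K) * opD K l x := by
    rw [model_range_iff, Prod.forall]
    refine forall_congr' fun i => forall_congr' fun j => ?_
    rw [iterAxiom, realize_close, forall_unit]
    simp only [Formula.realize_equal, realize_dTerm, realize_polyAt, Term.realize_var, map_sum,
      map_mul, map_natCast, FreeCommRing.lift_of]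
  have h5 : K ⊨ strictAxiom p e ↔ ∀ x, (∀ k : Fin e, opD K (Finsupp.single k 1) x = 0) ↔
      ∃ y, x = y ^ p := by
    rw [strictAxiom, realize_close, forall_unit]
    refine forall_congr' fun x => ?_
    rw [Formula.realize_iff, Formula.realize_iInf, Formula.realize_iExs]
    refine iff_congr (forall_congr' fun k => ?_) ?_
    · simp [realize_dTerm, realize_polyAt]
    · refine (Equiv.funUnique Unit K).exists_congr fun y => ?_
      simp [realize_polyAt]
  rw [h1, h2, h3, h4, h5]
  constructor
  · rintro ⟨⟨⟨⟨⟨h0, a1⟩, a2⟩, a3⟩, a4⟩, a5⟩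
    exact ⟨h0, a1, a2, a3, a4, a5⟩
  · rintro ⟨h0, a1, a2, a3, a4, a5⟩
    exact ⟨⟨⟨⟨⟨h0, a1⟩, a2⟩, a3⟩, a4⟩, a5⟩

theorem realize_basisFormula (p : ℕ) [Fact p.Prime] [Algebra (ZMod p) K] (i j : Fin e →₀ ℕ)
    (b : Fin e → K) : (basisFormula p e i j).Realize b ↔
      opD K j (∏ k, b k ^ i k) = MvPolynomial.aeval b (delta p e i j) := by
  rw [basisFormula, Formula.realize_equal, realize_dTerm, realize_polyAt, realize_polyAt,
    lift_liftAt]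
  simp

variable [(LStarB e).Structure K] [((LStar e).lhomWithConstants (Fin e)).IsExpansionOn K]

theorem model_WeDCFB_iff (p : ℕ) [Fact p.Prime] [Algebra (ZMod p) K] :
    K ⊨ WeDCFB p e ↔ K ⊨ SCF p e ∧ (alpha p e).Realize (fun k => ((LStar e).con k : K)) ∧
      IsStrictDerivation p (opD K (e := e)) ∧ ∀ i j : Fin e →₀ ℕ,
        opD K j (∏ k, ((LStar e).con k : K) ^ i k) =
          MvPolynomial.aeval (fun k => ((LStar e).con k : K)) (delta p e i j) := by
  rw [WeDCFB, Theory.model_union_iff, Theory.model_union_iff, Theory.model_singleton_iff,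
    LHom.onTheory_model, model_WeDCF_iff, Formula.realize_equivSentence, LHom.realize_onFormula,
    model_range_iff, Prod.forall]
  simp only [Formula.realize_equivSentence, realize_basisFormula]
  tauto

variable [(LZeroB e).Structure K] [(Language.ring.lhomWithConstants (Fin e)).IsExpansionOn K]
  [(zeroBToStarB e).IsExpansionOn K]

omit [(LStar e).Structure K] [(ringToStar e).IsExpansionOn K]
  [((LStar e).lhomWithConstants (Fin e)).IsExpansionOn K]
  [(Language.ring.lhomWithConstants (Fin e)).IsExpansionOn K] [Field K] [CompatibleRing K] in
theorem con_eq_con (k : Fin e) : (Language.ring.con k : K) = ((LStar e).con k : K) :=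
  ((zeroBToStarB e).map_onFunction (M := K) (Language.ring.con k) _).symm

omit [(LStar e).Structure K] [(ringToStar e).IsExpansionOn K] [(LStarB e).Structure K]
  [((LStar e).lhomWithConstants (Fin e)).IsExpansionOn K] [(zeroBToStarB e).IsExpansionOn K] in
theorem model_SCFB_iff (p : ℕ) :
    K ⊨ SCFB p e ↔ K ⊨ SCF p e ∧ (alpha p e).Realize (fun k => (Language.ring.con k : K)) := by
  rw [SCFB, Theory.model_union_iff, Theory.model_singleton_iff, LHom.onTheory_model,
    Formula.realize_equivSentence]

omit [(ringToStar e).IsExpansionOn K] in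
theorem model_SCFBStar_iff (p : ℕ) [Fact p.Prime] [Algebra (ZMod p) K] [CharP K p] :
    K ⊨ SCFBStar p e ↔ K ⊨ SCF p e ∧ (alpha p e).Realize (fun k => ((LStar e).con k : K)) ∧
      ∀ (j : Fin e →₀ ℕ) (n : ℕ), (∀ k, j k ≤ n) → ∀ x y, opD K j x = y ↔
        Psi p (fun k => ((LStar e).con k : K)) j n x y := by
  have hax : ∀ (j : Fin e →₀ ℕ) (n : ℕ), K ⊨ defAxiom p e j n ↔ ∀ x y, opD K j x = y ↔
        Psi p (fun k => ((LStar e).con k : K)) j n x y := by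
    intro j n
    rw [defAxiom, realize_close]
    simp only [Formula.realize_iff, LHom.realize_onFormula, realize_defFormula,
      Formula.realize_equal, realize_dTerm, Term.realize_var, con_eq_con]
    exact ⟨fun h x y => h (Sum.elim (fun _ => x) fun _ => y), fun h v => h _ _⟩
  rw [SCFBStar, Theory.model_union_iff, LHom.onTheory_model, model_SCFB_iff, and_assoc]
  simp only [con_eq_con]
  refine and_congr_right fun _ => and_congr_right fun _ => ⟨fun h j n hj => ?_, ?_⟩
  · exact (hax j n).1 ((Theory.model_iff _).1 h _ ⟨j, n, hj, rfl⟩)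
  · intro h
    refine (Theory.model_iff _).2 ?_
    rintro _ ⟨j, n, hj, rfl⟩
    exact (hax j n).2 (h j n hj)

end StarSemantics

/-! ### Comparison of the theories -/

section Comparison

variable (p e : ℕ) [hp : Fact p.Prime]

theorem model_SCFBStar_iff_model_WeDCFB_of_field {K : Type*} [Field K] [CompatibleRing K]
    [(LStar e).Structure K] [(ringToStar e).IsExpansionOn K] [(LStarB e).Structure K]
    [((LStar e).lhomWithConstants (Fin e)).IsExpansionOn K] [(LZeroB e).Structure K]
    [(Language.ring.lhomWithConstants (Fin e)).IsExpansionOn K]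
    [(zeroBToStarB e).IsExpansionOn K] (h : K ⊨ SCF p e) :
    K ⊨ SCFBStar p e ↔ K ⊨ WeDCFB p e := by
  have := charP_of_model_SCF p e h
  let _ : Algebra (ZMod p) K := ZMod.algebra K p
  rw [model_SCFBStar_iff, model_WeDCFB_iff]
  refine and_congr_right fun _ => and_congr_right fun hα => ?_
  have hb := isPBasis_of_model h _ hα
  rw [← hb.isTwistCompatible_iff]
  constructor
  · intro hD
    refine ⟨hb.isStrictDerivation hD, fun i j => ?_⟩
    have hX := hD.apply_aeval j (MvPolynomial.monomial i 1)
    rwa [MvPolynomial.aeval_monomial, map_one, one_mul,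
      Finsupp.prod_fintype _ _ (fun _ => pow_zero _)] at hX
  · rintro ⟨hD, hbD⟩
    exact hD.isTwistCompatible hbD

omit hp in
theorem model_field_of_model_SCF {M : Type*} [Language.ring.Structure M] (h : M ⊨ SCF p e) :
    Theory.field.Model M := by
  rw [SCF, Theory.model_union_iff, Theory.model_union_iff, Theory.fieldOfChar,
    Theory.model_union_iff] at h
  exact h.1.1.1

/-- The theories `(SCF_{p,e}^B)^*` and `W_e`-DCF^B have the same models. -/
theorem model_SCFBStar_iff_model_WeDCFB {M : Type*} [(LStarB e).Structure M] :
    M ⊨ SCFBStar p e ↔ M ⊨ WeDCFB p e := by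
  let _ : (LStar e).Structure M := ((LStar e).lhomWithConstants (Fin e)).reduct M
  let _ : (LZeroB e).Structure M := (zeroBToStarB e).reduct M
  let _ : Language.ring.Structure M := (ringToStar e).reduct M
  have : ((LStar e).lhomWithConstants (Fin e)).IsExpansionOn M := LHom.isExpansionOn_reduct _ _
  have : (zeroBToStarB e).IsExpansionOn M := LHom.isExpansionOn_reduct _ _
  have : (ringToStar e).IsExpansionOn M := LHom.isExpansionOn_reduct _ _
  have : (Language.ring.lhomWithConstants (Fin e)).IsExpansionOn M :=
    ⟨fun _ _ => rfl, fun _ _ => rfl⟩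
  have h1 : M ⊨ SCFBStar p e → M ⊨ SCF p e := by
    intro h
    rw [SCFBStar, Theory.model_union_iff, LHom.onTheory_model, SCFB, Theory.model_union_iff,
      LHom.onTheory_model] at h
    exact h.1.1
  have h2 : M ⊨ WeDCFB p e → M ⊨ SCF p e := by
    intro h
    simp only [WeDCFB, WeDCF, Theory.model_union_iff, LHom.onTheory_model] at h
    exact h.1.1.1.1.1.1.1
  -- Both theories contain `SCF p e`, which provides the field structure on the bare model.
  have key : M ⊨ SCF p e → (M ⊨ SCFBStar p e ↔ M ⊨ WeDCFB p e) := by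
    intro h
    have := model_field_of_model_SCF p e h
    let _ := Field.fieldOfModelField M
    let _ := Field.compatibleRingOfModelField M
    exact model_SCFBStar_iff_model_WeDCFB_of_field p e h
  exact ⟨fun h => (key (h1 h)).1 h, fun h => (key (h2 h)).2 h⟩

/-- The language lives in universe `0`, so `⊨ᵇ` only tests models in `Type`. -/
theorem consequences_subset_of_models {L : FirstOrder.Language.{0, 0}} {T T' : L.Theory}
    (h : ∀ (M : Type) [L.Structure M], M ⊨ T' → M ⊨ T) : consequences T ⊆ consequences T' := by
  intro φ hφ
  refine Theory.models_sentence_iff.2 fun M => ?_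
  have : M ⊨ T := h M M.is_model
  exact Theory.models_sentence_iff.1 hφ (Theory.ModelType.of T M)

theorem model_SCFB_defFormula {M : Type*} [(LZeroB e).Structure M] (h : M ⊨ SCFB p e) :
    (∀ (j : Fin e →₀ ℕ) (n : ℕ), (∀ k, j k ≤ n) → ∀ x : M,
      ∃! y, (defFormula p e j n).Realize (Sum.elim (fun _ => x) fun _ => y)) ∧
    ∀ (j : Fin e →₀ ℕ) (n m : ℕ), (∀ k, j k ≤ n) → (∀ k, j k ≤ m) → ∀ v : Unit ⊕ Unit → M,
      (defFormula p e j n).Realize v ↔ (defFormula p e j m).Realize v := by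
  let _ : Language.ring.Structure M := (Language.ring.lhomWithConstants (Fin e)).reduct M
  have : (Language.ring.lhomWithConstants (Fin e)).IsExpansionOn M :=
    LHom.isExpansionOn_reduct _ _
  have hSCF : M ⊨ SCF p e := by
    rw [SCFB, Theory.model_union_iff, LHom.onTheory_model] at h
    exact h.1
  have := model_field_of_model_SCF p e hSCF
  let _ := Field.fieldOfModelField M
  let _ := Field.compatibleRingOfModelField M
  have := charP_of_model_SCF p e hSCF
  let _ : Algebra (ZMod p) M := ZMod.algebra M p
  have hb := isPBasis_of_model hSCF _ ((model_SCFB_iff p).1 h).2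
  have hlt : ∀ {j : Fin e →₀ ℕ} {n : ℕ}, (∀ k, j k ≤ n) → ∀ k, j k < p ^ n :=
    fun h k => (h k).trans_lt (Nat.lt_pow_self hp.out.one_lt)
  constructor
  · intro j n hj x
    simp only [realize_defFormula]
    obtain ⟨y, hy⟩ := hb.exists_psi j n x
    exact ⟨y, hy, fun z hz => hb.psi_unique (hlt hj) hz hy⟩
  · intro j n m hn hm v
    rw [realize_defFormula, realize_defFormula]
    exact hb.psi_congr (hlt hn) (hlt hm) _ _

theorem isCanonicalBasis_of_model {K : Type*} [Field K] (D : (Fin e →₀ ℕ) → K → K)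
    (b : Fin e → K)
    (h : @Theory.Model (LStarB e) K (structureOf K D b) (WeDCFB p e)) :
    IsCanonicalBasis p D (Set.range b) := by
  -- These instances are the ones inside `structureOf`, so `opD` and the named constants unfold to
  -- `D` and `b`.
  let _ : CompatibleRing K := compatibleRingOfRing K
  let _ : (hsLang e).Structure K :=
    { funMap := fun f x => match f, x with
        | HSFunc.D j, x => D j (x 0)
      RelMap := fun r _ => r.elim }
  let _ : (constantsOn (Fin e)).Structure K := constantsOn.structure b
  have hSCF : K ⊨ SCF p e := by
    have h1 := h
    simp only [WeDCFB, WeDCF, Theory.model_union_iff, LHom.onTheory_model] at h1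
    exact h1.1.1.1.1.1.1.1
  have := charP_of_model_SCF p e hSCF
  let _ : Algebra (ZMod p) K := ZMod.algebra K p
  obtain ⟨-, hα, hD, hbD⟩ := (model_WeDCFB_iff (e := e) p).1 h
  have hb := isPBasis_of_model hSCF _ hα
  exact hb.isCanonicalBasis hD hbD

end Comparison

end

end WittSCF

theorem mainTheorem6 (p e : ℕ) [Fact p.Prime] (he : 0 < e) :
    -- the two theories have the same consequences
    WittSCF.consequences (WittSCF.SCFBStar p e) = WittSCF.consequences (WittSCF.WeDCFB p e) ∧
    -- the first one is an expansion of `SCF_{p,e}^B` by definitions: each defining formula defines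
    -- a function, and the defining formulas of the same symbol are equivalent
    (∀ (j : Fin e →₀ ℕ) (n : ℕ), (∀ k, j k ≤ n) →
      WittSCF.SCFB p e ⊨ᵇ (WittSCF.defFormula p e j n).iExsUnique Unit) ∧
    (∀ (j : Fin e →₀ ℕ) (n m : ℕ), (∀ k, j k ≤ n) → (∀ k, j k ≤ m) →
      WittSCF.SCFB p e ⊨ᵇ (WittSCF.defFormula p e j n).iff (WittSCF.defFormula p e j m)) ∧
    -- in every model of the second one the constants form a canonical `W_e`-basis
    (∀ (K : Type*) [Field K] (D : (Fin e →₀ ℕ) → K → K) (b : Fin e → K),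
      @FirstOrder.Language.Theory.Model (WittSCF.LStarB e) K (WittSCF.structureOf K D b)
        (WittSCF.WeDCFB p e) →
      WittSCF.IsCanonicalBasis p D (Set.range b)) := by
  refine ⟨?_, ?_, ?_, ?_⟩
  · exact Set.Subset.antisymm
      (WittSCF.consequences_subset_of_models fun M _ =>
        (WittSCF.model_SCFBStar_iff_model_WeDCFB p e (M := M)).2)
      (WittSCF.consequences_subset_of_models fun M _ =>
        (WittSCF.model_SCFBStar_iff_model_WeDCFB p e (M := M)).1)
  · intro j n hj
    refine Language.Theory.models_formula_iff.2 fun M v => ?_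
    rw [Language.Formula.realize_iExsUnique]
    obtain ⟨y, hy, huniq⟩ :=
      (WittSCF.model_SCFB_defFormula p e M.is_model).1 j n hj (v ())
    refine ⟨fun _ => y, hy, fun z hz => funext fun _ => huniq _ hz⟩
  · intro j n m hn hm
    refine Language.Theory.models_formula_iff.2 fun M v => ?_
    exact Language.Formula.realize_iff.2 ((WittSCF.model_SCFB_defFormula p e M.is_model).2 j n m hn hm v)
  · intro K _ D b h
    exact WittSCF.isCanonicalBasis_of_model p e D b h
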